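/- Let $X$ be a real $n\times N$ matrix of rank $n$ with nonzero columns, regarded as the multiset of its columns (subsets $Y\subset X$ are submatrices of columns). Let $\Pi=\mathbb{C}[t_1,\dots,t_n]$. For $p\in\Pi$ let $p(D)$ be the differential operator obtained by substituting $\partial/\partial t_k$ for $t_k$, and let $\langle p,q\rangle=(p(D)q)(0)$. For an ideal $J\subset\Pi$ put $\ker J=\{q\in\Pi:\ p(D)q=0\text{ for all }p\in J\}$. For $x\in\mathbb{R}^n$ let $p_x(t)=x\cdot t$, and for $Y\subset X$ let $p_Y=\prod_{y\in Y}p_y$. For $S\subset X$ let $\mathcal{P}(S)=\operatorname{span}\{p_Y:\ Y\subset S,\ \operatorname{rank}(S\setminus Y)=n\}$. Let $\mathbb{B}(X)$ be the set of all $B\subset X$ that are bases of $\mathbb{R}^n$. Fix a linearly independent $I\subset X$ and a total order $\prec$ on $X$ with $x\prec y$ for all $x\in X\setminus I$, $y\in I$. Set $\mathcal{P}_-(X,I)=\bigcap_{b\in I}\mathcal{P}(X\setminus b)$ if $I\neq\emptyset$, and $\mathcal{P}_-(X,\emptyset)=\mathcal{P}(X)$. A basis $B\in\mathbb{B}(X)$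 is *$I$-internal* if no $b\in B\cap I$ satisfies $b=\max\bigl(X\setminus\operatorname{span}(B\setminus b)\bigr)$; let $\mathbb{B}_-(X,I)$ be the set of $I$-internal bases. A subset $Y\subset X$ is *$I$-long* if $Y\cap B\neq\emptyset$ for every $B\in\mathbb{B}_-(X,I)$. Let $\mathcal{J}_-(X,I)$ be the ideal of $\Pi$ generated by all $p_Y$ with $Y\subset X$ $I$-long, and let $\mathcal{D}_-(X,I)=\ker\mathcal{J}_-(X,I)$. Let $\lambda\in\mathbb{R}^X$ be such that the arrangement of the hyperplanes $H_x=\{t\in\mathbb{R}^n:\ x\cdot t=\lambda_x\}$, $x\in X$, is simple, i.e. every subcollection of $m$ of them (indexed by $m$ columns) has an intersection that is either empty or of codimension $m$. For $B\in\mathbb{B}(X)$ let $v_B$ be the unique point of $\bigcap_{b\in B}H_b$, and let $V_-(X,\lambda,I)=\{v_B:\ B\in\mathbb{B}_-(X,I)\}$. For a finite $V\subset\mathbb{R}^n$ let $\operatorname{Exp}(V)$ be the complex span of the functions $t\mapsto e^{v\cdot t}$, $v\in V$; for $0\neq f\in\operatorname{Exp}(V)$ let $f_\downarrow$ be the nonzero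 term of lowest degree in the expansion $f=\sum_{j\ge0}f_j$ into homogeneous polynomials $f_j$ of degree $j$; and let $\Pi(V)=\operatorname{span}\{f_\downarrow:\ 0\ne f\in\operatorname{Exp}(V)\}$. **Theorem 3.5.** 1. $\mathcal{D}_-(X,I)=\Pi(V_-(X,\lambda,I))$; in particular, $\mathcal{D}_-(X,I)$ is finite-dimensional with $\dim\mathcal{D}_-(X,I)=\#\mathbb{B}_-(X,I)$. 2. $\mathcal{J}_-(X,I)\oplus\mathcal{P}_-(X,I)=\Pi$. 3. The map $p\mapsto\langle p,\cdot\rangle$ is an isomorphism from $\mathcal{P}_-(X,I)$ onto the dual space $\mathcal{D}_-(X,I)^*$. -/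

import Mathlib

noncomputable section

namespace Zonotopal

/-! ### Polynomials, differential operators and the pairing -/

/-- The space `Π = ℂ[t₁, …, tₙ]`. -/
abbrev Poly (n : ℕ) : Type := MvPolynomial (Fin n) ℂ

/-- The constant coefficient operator `∂^m = ∂₁^{m₁} ⋯ ∂ₙ^{mₙ}` on `Π`. -/
def monomialOp {n : ℕ} (m : Fin n →₀ ℕ) : Module.End ℂ (Poly n) :=
  (List.ofFn fun i : Fin n =>
    ((MvPolynomial.pderiv i : Derivation ℂ (Poly n) (Poly n)) : Poly n →ₗ[ℂ] Poly n) ^ m i).prod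

/-- `p ↦ p(D)`: the linear map that sends each monomial `t^m` to `∂^m`. -/
def diffOp (n : ℕ) : Poly n →ₗ[ℂ] (Poly n →ₗ[ℂ] Poly n) :=
  (MvPolynomial.basisMonomials (Fin n) ℂ).constr ℂ monomialOp

/-- The pairing `⟨p, q⟩ = (p(D) q)(0)`, as a bilinear form on `Π`. -/
def pairing (n : ℕ) : Poly n →ₗ[ℂ] (Poly n →ₗ[ℂ] ℂ) :=
  (diffOp n).compr₂ (MvPolynomial.aeval (0 : Fin n → ℂ)).toLinearMap

/-- `ker J = {q : p(D) q = 0 for all p ∈ J}`. -/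
def idealKer {n : ℕ} (J : Ideal (Poly n)) : Submodule ℂ (Poly n) :=
  ⨅ p ∈ J, LinearMap.ker (diffOp n p)

/-! ### The least space -/

/-- The exponential `e_v : t ↦ e^{v · t}`. -/
def expFun {n : ℕ} (v : Fin n → ℝ) : (Fin n → ℝ) → ℂ :=
  fun t => Complex.exp ((v ⬝ᵥ t : ℝ) : ℂ)

/-- `Exp(V)`, the linear span of the exponentials with frequencies in `V`. -/
def expSpace {n : ℕ} (V : Set (Fin n → ℝ)) : Submodule ℂ ((Fin n → ℝ) → ℂ) :=
  Submodule.span ℂ (expFun '' V)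

/-- `f = ∑ⱼ Fⱼ` is the homogeneous power expansion of `f`, where `Fⱼ` is homogeneous of
degree `j`. -/
def IsHomogeneousExpansion {n : ℕ} (f : (Fin n → ℝ) → ℂ) (F : ℕ → Poly n) : Prop :=
  (∀ j, (F j).IsHomogeneous j) ∧
    ∀ t : Fin n → ℝ, HasSum (fun j => MvPolynomial.eval (fun i => (t i : ℂ)) (F j)) (f t)

/-- `q = f↓`: `q` is the first nonzero term of the homogeneous power expansion of `f`. -/
def IsLeastTerm {n : ℕ} (f : (Fin n → ℝ) → ℂ) (q : Poly n) : Prop :=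
  ∃ F : ℕ → Poly n, IsHomogeneousExpansion f F ∧
    ∃ j, F j ≠ 0 ∧ (∀ i < j, F i = 0) ∧ q = F j

/-- `Π(V) = span {f↓ : f ∈ Exp(V) \ 0}`. -/
def leastSpace {n : ℕ} (V : Set (Fin n → ℝ)) : Submodule ℂ (Poly n) :=
  Submodule.span ℂ {q | ∃ f ∈ expSpace V, f ≠ 0 ∧ IsLeastTerm f q}

/-! ### The columns of a matrix

A matrix with `n` rows is given by the family `X` of its columns, `X i ∈ ℝⁿ` for `i : ι`; a
submatrix is given by its set of column indices, so that repeated columns stay distinct. -/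

section Columns

variable {n : ℕ} {ι : Type*}

/-- The rank of the submatrix with column set `S`. -/
def rk (X : ι → Fin n → ℝ) (S : Finset ι) : ℕ :=
  Module.finrank ℝ (Submodule.span ℝ (X '' (S : Set ι)))

/-- The columns in `S` are linearly independent: `S ∈ 𝕀(X)`. -/
def IsIndep (X : ι → Fin n → ℝ) (S : Finset ι) : Prop :=
  LinearIndependent ℝ (fun i : S => X i)

/-- The columns in `B` form a basis of `ℝⁿ`: `B ∈ 𝔹(X)`. -/
def IsBasis (X : ι → Fin n → ℝ) (B : Finset ι) : Prop :=
  IsIndep X B ∧ Submodule.span ℝ (X '' (B : Set ι)) = ⊤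

/-- The linear form `p_x : t ↦ x · t`, as a polynomial. -/
def linForm (x : Fin n → ℝ) : Poly n :=
  ∑ k, MvPolynomial.C (x k : ℂ) * MvPolynomial.X k

/-- `p_Y = ∏_{y ∈ Y} p_y`. -/
def prodForm (X : ι → Fin n → ℝ) (Y : Finset ι) : Poly n :=
  ∏ y ∈ Y, linForm (X y)

/-- The central space `𝒫(S)` of the submatrix with column set `S`, i.e. the span of the
polynomials `p_Y` with `Y ⊆ S` and `rank (S \ Y) = n`. -/
def centralSpace [DecidableEq ι] (X : ι → Fin n → ℝ) (S : Finset ι) : Submodule ℂ (Poly n) :=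
  Submodule.span ℂ {q | ∃ Y ⊆ S, rk X (S \ Y) = n ∧ q = prodForm X Y}

/-- `𝒫₋(X, I) = ⋂_{b ∈ I} 𝒫(X \ b)`. The intersection is formed inside `𝒫(X)`, which contains
every `𝒫(X \ b)`; so this matters only for `I = ∅`, where the space is `𝒫(X)`. -/
def semiInternalSpace [Fintype ι] [DecidableEq ι] (X : ι → Fin n → ℝ) (I : Finset ι) :
    Submodule ℂ (Poly n) :=
  centralSpace X Finset.univ ⊓ ⨅ b ∈ I, centralSpace X (Finset.univ.erase b)

/-! ### The hyperplane arrangement -/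

/-- The hyperplane `{t : xᵢ · t = λᵢ}`. -/
def hyperplane (X : ι → Fin n → ℝ) (lam : ι → ℝ) (i : ι) : Set (Fin n → ℝ) :=
  {t | X i ⬝ᵥ t = lam i}

/-- The arrangement is simple: every subcollection of `m` hyperplanes has an intersection that is
either empty or of codimension `m`. -/
def IsSimple (X : ι → Fin n → ℝ) (lam : ι → ℝ) : Prop :=
  ∀ S : Finset ι, (⋂ i ∈ S, hyperplane X lam i) = ∅ ∨
    Module.finrank ℝ (vectorSpan ℝ (⋂ i ∈ S, hyperplane X lam i)) + S.card = n

/-! ### `I`-internal bases and `I`-long sets -/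

variable [LinearOrder ι]

/-- `b ∈ B` is `I`-internally active in `B`: `b ∈ I`, and `b` is the last column outside
`span (B \ b)`. -/
def IsInternallyActive (X : ι → Fin n → ℝ) (I B : Finset ι) (b : ι) : Prop :=
  b ∈ I ∧ IsGreatest {i | X i ∉ Submodule.span ℝ (X '' (B.erase b : Set ι))} b

/-- `𝔹₋(X, I)`, the set of `I`-internal bases. -/
def internalBases (X : ι → Fin n → ℝ) (I : Finset ι) : Set (Finset ι) :=
  {B | IsBasis X B ∧ ∀ b ∈ B, ¬ IsInternallyActive X I B b}

/-- `Y` is `I`-long if it meets every `I`-internal basis. -/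
def IsLong (X : ι → Fin n → ℝ) (I Y : Finset ι) : Prop :=
  ∀ B ∈ internalBases X I, (Y ∩ B).Nonempty

/-- `𝒥₋(X, I)`, the ideal generated by `p_Y` for all `I`-long `Y`. -/
def longIdeal (X : ι → Fin n → ℝ) (I : Finset ι) : Ideal (Poly n) :=
  Ideal.span {q | ∃ Y : Finset ι, IsLong X I Y ∧ q = prodForm X Y}

/-- `𝒟₋(X, I) = ker 𝒥₋(X, I)`. -/
def dualSpace (X : ι → Fin n → ℝ) (I : Finset ι) : Submodule ℂ (Poly n) :=
  idealKer (longIdeal X I)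

/-- `V₋(X, λ, I) = {v_B : B ∈ 𝔹₋(X, I)}`, where the vertex `v_B` is the only common point of the
hyperplanes of the columns in the basis `B`. -/
def internalVertices (X : ι → Fin n → ℝ) (lam : ι → ℝ) (I : Finset ι) : Set (Fin n → ℝ) :=
  {v | ∃ B ∈ internalBases X I, v ∈ ⋂ b ∈ B, hyperplane X lam b}

end Columns

end Zonotopal

end

noncomputable section

namespace Zonotopal

/-! Write `J` for the ideal of the long products, and count internal bases. The proof bounds the
codimension of `J` by that number on both sides, and then shows that `𝒫₋` has the same dimension and
meets `J` only in `0`.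

Codimension of `J`. All statements are extended to minors: `W` is the span of the contracted
columns, `S` the set of remaining ones, and polynomials matter only on `W^⊥`. Removing the first
column `x` of `S`, multiplication by `p_x` relates the ideal of the minor to those of its deletion
and contraction; internal bases split in the same way, so the codimension is at most their number
(`finrank_quotientSpace_minorIdeal_le`). Conversely, if `Y` is long, `∏ (p_y - λ_y)` vanishes at
every internal vertex and has leading form `p_Y`; hence the least space of the vertices lies in `ker
J`. Its dimension is at least the number of vertices (`leastSpace_eval_surjective`), and simplicity
makes the vertices distinct. All the inequalities are therefore equalities, which gives the
statements on `𝒟₋`.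

The space `𝒫₋`. It is described by degree bounds along the normals of the hyperplanes spanned by
columns (`facetKernel`, `semiInternalSpace_eq_facetKernel`). An induction over minors, which uses
that the deletion-contraction bound is sharp, shows that these conditions are transversal to `J`
(`mem_vanishing_of_mem_facetKernel`), so `dim 𝒫₋` is at most the number of internal bases. The
reverse inequality is by induction on `I`: enlarging `I` by the column `c` just before it imposes
one more condition for each spanned hyperplane that contains `I` and avoids `c`, and the rank of
that condition is at most the number of internal bases of a minor, which are accounted for by the
bases in which `c` becomes active (`card_minorBases_le_finrank_facetKernel`).

Direct sum and duality then follow from the equality of dimensions. -/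

open MvPolynomial

/-! ### Differential operators and the pairing. -/

section Pairing

variable {n : ℕ}

/-- The partial derivative, as an endomorphism of the space of polynomials. -/
def pderivEnd (i : Fin n) : Module.End ℂ (Poly n) :=
  ((pderiv i : Derivation ℂ (Poly n) (Poly n)) : Poly n →ₗ[ℂ] Poly n)

theorem pderivEnd_apply (i : Fin n) (p : Poly n) : pderivEnd i p = pderiv i p := rfl

theorem pderivEnd_comm (i j : Fin n) :
    pderivEnd i * pderivEnd j = pderivEnd j * (pderivEnd i : Module.End ℂ (Poly n)) := by
  have h : ⁅(pderiv i : Derivation ℂ (Poly n) (Poly n)),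
      (pderiv j : Derivation ℂ (Poly n) (Poly n))⁆ = 0 := by
    apply MvPolynomial.derivation_ext
    intro k
    classical
    simp [Derivation.commutator_apply, pderiv_X, Pi.single_apply, apply_ite]
  refine LinearMap.ext fun p => ?_
  have := congrArg (fun d : Derivation ℂ (Poly n) (Poly n) => d p) h
  simp only [Derivation.commutator_apply, Derivation.zero_apply, sub_eq_zero] at this
  exact this

theorem diffOp_monomial (m : Fin n →₀ ℕ) : diffOp n (monomial m 1) = monomialOp m := by
  have := (basisMonomials (Fin n) ℂ).constr_basis ℂ (monomialOp (n := n)) m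
  simpa [diffOp] using this

-- `diffOp` is prescribed on monomials by ordered products of operators. The partial derivatives
-- commute, so `aeval` into the commutative subalgebra they generate is multiplicative, and it
-- agrees with `diffOp` on monomials.
open scoped IsMulCommutative in
theorem exists_diffOp_algHom (n : ℕ) :
    ∃ φ : Poly n →ₐ[ℂ] Module.End ℂ (Poly n),
      (∀ i, φ (X i) = pderivEnd i) ∧ ∀ p, φ p = diffOp n p := by
  let s : Set (Module.End ℂ (Poly n)) := Set.range pderivEnd
  have : IsMulCommutative (Algebra.adjoin ℂ s) := Algebra.isMulCommutative_adjoin ℂ (by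
    rintro _ ⟨i, rfl⟩ _ ⟨j, rfl⟩
    exact pderivEnd_comm i j)
  let d : Fin n → Algebra.adjoin ℂ s := fun i =>
    ⟨pderivEnd i, Algebra.subset_adjoin ⟨i, rfl⟩⟩
  let φ : Poly n →ₐ[ℂ] Module.End ℂ (Poly n) := (Algebra.adjoin ℂ s).val.comp (aeval d)
  have hX : ∀ i, φ (X i) = pderivEnd i := by
    intro i
    simp [φ, d]
  refine ⟨φ, hX, fun p => ?_⟩
  have : φ.toLinearMap = diffOp n := by
    refine (basisMonomials (Fin n) ℂ).ext fun m => ?_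
    simp only [coe_basisMonomials, AlgHom.toLinearMap_apply]
    rw [diffOp_monomial, monomialOp]
    have h1 : (monomial m (1 : ℂ) : Poly n) = (List.ofFn fun i => X i ^ m i).prod := by
      rw [List.prod_ofFn, monomial_eq, Finsupp.prod_fintype _ _ (by simp)]
      simp
    rw [h1, map_list_prod, List.map_ofFn]
    congr 2
    funext i
    simp [Function.comp, hX, pderivEnd]
  exact congrArg (fun f => f p) this

theorem diffOp_mul (p q : Poly n) : diffOp n (p * q) = diffOp n p * diffOp n q := by
  obtain ⟨φ, -, h⟩ := exists_diffOp_algHom n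
  rw [← h, ← h, ← h, map_mul]

theorem diffOp_one : diffOp n 1 = 1 := by
  obtain ⟨φ, -, h⟩ := exists_diffOp_algHom n
  rw [← h, map_one]

theorem diffOp_X (i : Fin n) : diffOp n (X i) = pderivEnd i := by
  obtain ⟨φ, hX, h⟩ := exists_diffOp_algHom n
  rw [← h, hX]

theorem pairing_apply (p q : Poly n) : pairing n p q = coeff 0 (diffOp n p q) := by
  simp only [pairing, LinearMap.compr₂_apply, AlgHom.toLinearMap_apply]
  rw [aeval_zero]
  rfl

theorem pairing_mul (p q f : Poly n) : pairing n (p * q) f = pairing n p (diffOp n q f) := by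
  simp [pairing_apply, diffOp_mul]

theorem pairing_mul_X (p : Poly n) (i : Fin n) (f : Poly n) :
    pairing n (p * X i) f = pairing n p (pderiv i f) := by
  rw [pairing_mul, diffOp_X, pderivEnd_apply]

theorem pairing_one (f : Poly n) : pairing n 1 f = coeff 0 f := by
  simp [pairing_apply, diffOp_one]

/-- The product of the factorials of a multi-exponent. -/
def multiFactorial (m : Fin n →₀ ℕ) : ℕ := ∏ i, (m i).factorial

theorem multiFactorial_pos (m : Fin n →₀ ℕ) : 0 < multiFactorial m :=
  Finset.prod_pos fun _ _ => Nat.factorial_pos _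

theorem multiFactorial_add_single (m : Fin n →₀ ℕ) (i : Fin n) :
    multiFactorial (m + Finsupp.single i 1) = (m i + 1) * multiFactorial m := by
  classical
  unfold multiFactorial
  rw [← Finset.mul_prod_erase _ _ (Finset.mem_univ i),
    ← Finset.mul_prod_erase _ (fun j => (m j).factorial) (Finset.mem_univ i), ← mul_assoc]
  congr 1
  · simp [Nat.factorial_succ]
  · refine Finset.prod_congr rfl fun j hj => ?_
    simp [(Finset.ne_of_mem_erase hj).symm]

theorem pairing_monomial (m : Fin n →₀ ℕ) (c : ℂ) (f : Poly n) :
    pairing n (monomial m c) f = c * multiFactorial m * coeff m f := by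
  have h : ∀ m : Fin n →₀ ℕ, ∀ f : Poly n,
      pairing n (monomial m 1) f = multiFactorial m * coeff m f := by
    intro m
    induction hd : m.degree generalizing m with
    | zero =>
      intro f
      obtain rfl : m = 0 := (Finsupp.degree_eq_zero_iff m).1 hd
      have : (monomial (0 : Fin n →₀ ℕ) (1 : ℂ) : Poly n) = 1 := rfl
      rw [this, pairing_one]
      simp [multiFactorial]
    | succ d ih =>
      intro f
      have hm : m ≠ 0 := by
        rintro rfl
        simp at hd
      obtain ⟨i, hi⟩ := Finsupp.ne_iff.1 hm
      obtain ⟨m', rfl⟩ : ∃ m', m = m' + Finsupp.single i 1 :=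
        ⟨m - Finsupp.single i 1, (tsub_add_cancel_of_le (by
          rw [Finsupp.single_le_iff]
          exact Nat.one_le_iff_ne_zero.2 hi)).symm⟩
      rw [map_add, Finsupp.degree_single, add_left_inj] at hd
      rw [show (monomial (m' + Finsupp.single i 1) (1 : ℂ) : Poly n) = monomial m' 1 * X i by
        rw [X, monomial_mul, one_mul], pairing_mul_X, ih m' hd, coeff_pderiv,
        multiFactorial_add_single]
      push_cast
      ring
  have hc : (monomial m c : Poly n) = c • monomial m 1 := by simp [smul_monomial]
  rw [hc, map_smul, LinearMap.smul_apply, h, smul_eq_mul, mul_assoc]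

theorem pairing_eq_sum (p q : Poly n) :
    pairing n p q = ∑ m ∈ p.support, coeff m p * multiFactorial m * coeff m q := by
  conv_lhs => rw [p.as_sum]
  rw [map_sum, LinearMap.sum_apply]
  exact Finset.sum_congr rfl fun m _ => pairing_monomial _ _ _

theorem eq_zero_of_pairing_eq_zero {q : Poly n} (h : ∀ p, pairing n p q = 0) : q = 0 := by
  ext m
  have := h (monomial m 1)
  rw [pairing_monomial] at this
  simpa [(multiFactorial_pos m).ne'] using this

/-- Scalar conditions suffice because `J` absorbs products: `⟨r, p(D) q⟩ = ⟨r p, q⟩`, and the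
pairing is nondegenerate. -/
theorem mem_idealKer_iff {J : Ideal (Poly n)} {q : Poly n} :
    q ∈ idealKer J ↔ ∀ p ∈ J, pairing n p q = 0 := by
  simp only [idealKer, Submodule.mem_iInf, LinearMap.mem_ker]
  constructor
  · intro h p hp
    rw [pairing_apply, h p hp, coeff_zero]
  · intro h p hp
    refine eq_zero_of_pairing_eq_zero fun r => ?_
    rw [← pairing_mul]
    exact h _ (J.mul_mem_left _ hp)

/-- Complex conjugation of the coefficients of a polynomial. -/
def conjPoly (p : Poly n) : Poly n := MvPolynomial.map (starRingEnd ℂ) p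

/-- The bilinear pairing has isotropic vectors over `ℂ`; conjugating one argument turns it into a
positive definite Hermitian form. -/
theorem pairing_conjPoly_self_ne_zero {q : Poly n} (hq : q ≠ 0) : pairing n (conjPoly q) q ≠ 0 := by
  have h : pairing n (conjPoly q) q =
      ((∑ m ∈ (conjPoly q).support, multiFactorial m * Complex.normSq (coeff m q) : ℝ) : ℂ) := by
    rw [pairing_eq_sum]
    push_cast
    refine Finset.sum_congr rfl fun m _ => ?_
    rw [conjPoly, coeff_map, Complex.normSq_eq_conj_mul_self]
    ring
  rw [h]
  norm_cast
  apply ne_of_gt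
  apply Finset.sum_pos
  · intro m hm
    have : coeff m q ≠ 0 := by
      rw [mem_support_iff, conjPoly, coeff_map] at hm
      simpa using hm
    have h2 := multiFactorial_pos m
    have := Complex.normSq_pos.2 this
    positivity
  · rw [Finset.nonempty_iff_ne_empty, Ne, support_eq_empty]
    intro h0
    apply hq
    apply MvPolynomial.map_injective _ (starRingEnd ℂ).injective
    rw [map_zero]
    exact h0

theorem eval_conjPoly (p : Poly n) (v : Fin n → ℝ) :
    eval (fun i => (v i : ℂ)) (conjPoly p) =
      (starRingEnd ℂ) (eval (fun i => (v i : ℂ)) p) := by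
  rw [conjPoly, eval_map, ← coe_eval₂Hom]
  have : (starRingEnd ℂ).comp (eval (fun i => (v i : ℂ))) =
      eval₂Hom (starRingEnd ℂ) (fun i => (v i : ℂ)) := by
    ext <;> simp
  rw [← this]
  rfl

end Pairing

/-! ### Linear forms and evaluation at real points. -/

section LinearForms

variable {n : ℕ}

/-- Evaluation of a polynomial at a real point. -/
def evalReal (v : Fin n → ℝ) : Poly n →ₐ[ℂ] ℂ := aeval fun i => (v i : ℂ)

theorem evalReal_eq_eval (v : Fin n → ℝ) (p : Poly n) :
    evalReal v p = eval (fun i => (v i : ℂ)) p := by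
  rw [evalReal, aeval_eq_eval]

theorem eq_zero_of_evalReal_eq_zero {p : Poly n} (h : ∀ v, evalReal v p = 0) : p = 0 := by
  refine MvPolynomial.funext_set (fun _ => Set.range ((↑) : ℝ → ℂ))
    (fun _ => Set.infinite_range_of_injective Complex.ofReal_injective) ?_
  intro x hx
  choose v hv using fun i => hx i (Set.mem_univ i)
  have := h v
  rw [evalReal_eq_eval] at this
  have hxv : x = fun i => (v i : ℂ) := funext fun i => (hv i).symm
  rw [hxv, this, map_zero]

theorem evalReal_linForm (v x : Fin n → ℝ) : evalReal v (linForm x) = ((x ⬝ᵥ v : ℝ) : ℂ) := by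
  simp [evalReal, linForm, dotProduct]

theorem linForm_add (x y : Fin n → ℝ) : linForm (x + y) = linForm x + linForm y := by
  simp [linForm, add_mul, Finset.sum_add_distrib]

theorem linForm_smul (c : ℝ) (x : Fin n → ℝ) : linForm (c • x) = (c : ℂ) • linForm x := by
  simp [linForm, Finset.smul_sum, smul_eq_C_mul, mul_assoc]

/-- The map `x ↦ p_x` as a linear map. -/
def linFormHom (n : ℕ) : (Fin n → ℝ) →ₗ[ℝ] Poly n where
  toFun := linForm
  map_add' := linForm_add
  map_smul' c x := by rw [linForm_smul]; rfl

theorem isHomogeneous_linForm (x : Fin n → ℝ) : (linForm x).IsHomogeneous 1 := by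
  refine IsHomogeneous.sum _ _ _ fun i _ => ?_
  simpa using (isHomogeneous_C (Fin n) (x i : ℂ)).mul (isHomogeneous_X ℂ i)

theorem linForm_single (i : Fin n) : linForm (Pi.single i 1) = X i := by
  simp [linForm, Pi.single_apply, apply_ite]

theorem pderiv_linForm (i : Fin n) (x : Fin n → ℝ) : pderiv i (linForm x) = C (x i : ℂ) := by
  classical
  simp [linForm, pderiv_X, Pi.single_apply]

end LinearForms

/-! ### Leading forms of inhomogeneous polynomials. -/

section LeadingForms

variable {n : ℕ}

/-- All monomials of `p` have degree less than `d`. -/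
def DegreeBelow (d : ℕ) (p : Poly n) : Prop := ∀ m : Fin n →₀ ℕ, d ≤ m.degree → coeff m p = 0

theorem DegreeBelow.add {d : ℕ} {p q : Poly n} (hp : DegreeBelow d p) (hq : DegreeBelow d q) :
    DegreeBelow d (p + q) := fun m hm => by rw [coeff_add, hp m hm, hq m hm, add_zero]

theorem DegreeBelow.mul {d e : ℕ} {p q : Poly n} (hp : DegreeBelow d p)
    (hq : DegreeBelow (e + 1) q) : DegreeBelow (d + e) (p * q) := by
  classical
  intro m hm
  rw [coeff_mul]
  refine Finset.sum_eq_zero fun x hx => ?_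
  rw [Finset.HasAntidiagonal.mem_antidiagonal] at hx
  rw [← hx, map_add] at hm
  by_cases h : d ≤ x.1.degree
  · rw [hp _ h, zero_mul]
  · rw [hq _ (by omega), mul_zero]

theorem DegreeBelow.mono {d e : ℕ} (h : d ≤ e) {p : Poly n} (hp : DegreeBelow d p) :
    DegreeBelow e p := fun m hm => hp m (h.trans hm)

theorem degreeBelow_of_isHomogeneous {d : ℕ} {p : Poly n} (hp : p.IsHomogeneous d) :
    DegreeBelow (d + 1) p := fun m hm => hp.coeff_eq_zero (by omega)

/-- `g` is homogeneous of degree `d` and `P - g` has degree less than `d`. -/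
def IsLeadingForm (d : ℕ) (g P : Poly n) : Prop := g.IsHomogeneous d ∧ DegreeBelow d (P - g)

theorem IsLeadingForm.degreeBelow {d : ℕ} {g P : Poly n} (h : IsLeadingForm d g P) :
    DegreeBelow (d + 1) P := by
  have := (degreeBelow_of_isHomogeneous h.1).add (h.2.mono (Nat.le_succ d))
  rwa [add_sub_cancel] at this

theorem IsLeadingForm.mul {d e : ℕ} {g P h Q : Poly n} (hg : IsLeadingForm d g P)
    (hh : IsLeadingForm e h Q) : IsLeadingForm (d + e) (g * h) (P * Q) := by
  refine ⟨hg.1.mul hh.1, ?_⟩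
  have : P * Q - g * h = (P - g) * Q + (Q - h) * g := by ring
  rw [this]
  refine (hg.2.mul hh.degreeBelow).add ?_
  rw [add_comm d e]
  exact hh.2.mul (degreeBelow_of_isHomogeneous hg.1)

theorem isLeadingForm_linForm_sub_C (x : Fin n → ℝ) (c : ℂ) :
    IsLeadingForm 1 (linForm x) (linForm x - C c) := by
  refine ⟨isHomogeneous_linForm x, ?_⟩
  rw [sub_sub_cancel_left, ← C_neg]
  exact degreeBelow_of_isHomogeneous (isHomogeneous_C _ _)

theorem isLeadingForm_prod {ι : Type*} (Y : Finset ι) (x : ι → Fin n → ℝ) (c : ι → ℂ) :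
    IsLeadingForm Y.card (∏ y ∈ Y, linForm (x y)) (∏ y ∈ Y, (linForm (x y) - C (c y))) := by
  classical
  induction Y using Finset.induction_on with
  | empty =>
    refine ⟨by simpa using isHomogeneous_one (Fin n) ℂ, fun m _ => by simp⟩
  | insert a s ha ih =>
    rw [Finset.prod_insert ha, Finset.prod_insert ha, Finset.card_insert_of_notMem ha, add_comm]
    exact (isLeadingForm_linForm_sub_C _ _).mul ih

end LeadingForms

/-! ### Exponential sums and the least space. -/

section Exponentials

variable {n : ℕ}

/-- The degree `m` term `(v · t)^m / m!` of the exponential with frequency `v`. -/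
def expTerm (m : ℕ) (v : Fin n → ℝ) : Poly n := ((m.factorial : ℂ)⁻¹) • linForm v ^ m

theorem pderiv_expTerm_succ (i : Fin n) (m : ℕ) (v : Fin n → ℝ) :
    pderiv i (expTerm (m + 1) v) = (v i : ℂ) • expTerm m v := by
  rw [expTerm, Derivation.map_smul, pderiv_pow, pderiv_linForm, expTerm, Nat.add_sub_cancel, smul_smul,
    Nat.factorial_succ]
  have h1 : ((m + 1 : ℕ) : Poly n) = C ((m + 1 : ℕ) : ℂ) := by simp
  rw [h1, smul_eq_C_mul, smul_eq_C_mul, mul_right_comm, ← C_mul, ← mul_assoc, ← C_mul]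
  congr 2
  have : (m.factorial : ℂ) ≠ 0 := by exact_mod_cast m.factorial_ne_zero
  have : (m + 1 : ℂ) ≠ 0 := by exact_mod_cast m.succ_ne_zero
  push_cast
  field_simp

theorem expTerm_zero (v : Fin n → ℝ) : expTerm 0 v = 1 := by simp [expTerm]

theorem isHomogeneous_expTerm (m : ℕ) (v : Fin n → ℝ) : (expTerm m v).IsHomogeneous m := by
  rw [expTerm, smul_eq_C_mul]
  simpa using (isHomogeneous_C (Fin n) ((m.factorial : ℂ)⁻¹)).mul ((isHomogeneous_linForm v).pow m)

theorem homogeneousComponent_succ_mul_X (m : ℕ) (p : Poly n) (i : Fin n) :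
    homogeneousComponent (m + 1) (p * X i) = homogeneousComponent m p * X i := by
  classical
  ext d
  rw [coeff_homogeneousComponent, coeff_mul_X', coeff_mul_X', coeff_homogeneousComponent]
  by_cases hi : i ∈ d.support
  · obtain ⟨d', rfl⟩ : ∃ d', d = d' + Finsupp.single i 1 :=
      ⟨d - Finsupp.single i 1, (tsub_add_cancel_of_le (by
        rw [Finsupp.single_le_iff]
        exact Nat.one_le_iff_ne_zero.2 (Finsupp.mem_support_iff.1 hi))).symm⟩
    simp [hi]
  · simp [hi]

/-- The identity `⟨p, e_v⟩ = p(v)`, one degree at a time: `e_v` is an eigenvector of every `∂_i`,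
with eigenvalue `v i`. -/
theorem pairing_expTerm (p : Poly n) (m : ℕ) (v : Fin n → ℝ) :
    pairing n p (expTerm m v) = evalReal v (homogeneousComponent m p) := by
  induction p using MvPolynomial.induction_on generalizing m with
  | C a =>
    have h : pairing n (C a) (expTerm m v) = a * coeff 0 (expTerm m v) := by
      have := pairing_monomial 0 a (expTerm m v)
      simpa [multiFactorial] using this
    rw [h]
    rcases Nat.eq_zero_or_pos m with rfl | hm
    · rw [expTerm_zero, homogeneousComponent_zero]
      simp [evalReal]
    · rw [(isHomogeneous_expTerm m v).coeff_eq_zero (by simpa using hm.ne),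
        homogeneousComponent_eq_zero _ _ (by simpa using hm)]
      simp
  | add p q hp hq => simp [hp, hq]
  | mul_X p i ih =>
    rw [pairing_mul_X]
    cases m with
    | zero =>
      rw [expTerm_zero, homogeneousComponent_zero]
      simp [coeff_mul_X']
    | succ m =>
      rw [pderiv_expTerm_succ, map_smul, ih, homogeneousComponent_succ_mul_X, map_mul]
      simp [evalReal, mul_comm]

theorem hasSum_expTerm (v t : Fin n → ℝ) :
    HasSum (fun j => evalReal t (expTerm j v)) (expFun v t) := by
  have h := NormedSpace.expSeries_div_hasSum_exp (((v ⬝ᵥ t : ℝ) : ℂ))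
  rw [expFun, Complex.exp_eq_exp_ℂ]
  refine Eq.subst (motive := fun f => HasSum f _) (funext fun j => ?_) h
  symm
  change evalReal t (((j.factorial : ℂ)⁻¹) • linForm v ^ j) = _
  rw [map_smul, map_pow, evalReal_linForm, smul_eq_mul]
  ring

/-- Along the ray `s ↦ s t` the homogeneous terms become the coefficients of a power series in `s`,
and these are unique. -/
theorem IsHomogeneousExpansion.unique {f : (Fin n → ℝ) → ℂ} {F G : ℕ → Poly n}
    (hF : IsHomogeneousExpansion f F) (hG : IsHomogeneousExpansion f G) : F = G := by
  funext j
  rw [← sub_eq_zero]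
  refine eq_zero_of_evalReal_eq_zero fun t => ?_
  rw [map_sub, evalReal_eq_eval, evalReal_eq_eval]
  set a : ℕ → ℂ := fun j => eval (fun i => (t i : ℂ)) (F j) - eval (fun i => (t i : ℂ)) (G j)
  have hscale : ∀ (s : ℝ) (p : Poly n) (k : ℕ), p.IsHomogeneous k →
      eval (fun i => (((s • t) i : ℝ) : ℂ)) p = (s : ℂ) ^ k * eval (fun i => (t i : ℂ)) p := by
    intro s p k hp
    rw [eval_eq', eval_eq', Finset.mul_sum]
    refine Finset.sum_congr rfl fun d hd => ?_
    have hdeg : ∑ i, d i = k := by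
      rw [← Finsupp.degree_eq_sum]
      by_contra h
      exact (mem_support_iff.1 hd) (hp.coeff_eq_zero h)
    simp only [Pi.smul_apply, smul_eq_mul, Complex.ofReal_mul, mul_pow]
    rw [Finset.prod_mul_distrib, Finset.prod_pow_eq_pow_sum, hdeg]
    ring
  have hsum : ∀ s : ℝ, HasSum (fun k => s ^ k • a k) 0 := by
    intro s
    have h := (hF.2 (s • t)).sub (hG.2 (s • t))
    rw [sub_self] at h
    refine Eq.subst (motive := fun f => HasSum f _) (funext fun k => ?_) h
    symm
    change s ^ k • (_ - _) = _
    rw [hscale s _ k (hF.1 k), hscale s _ k (hG.1 k), ← mul_sub, Complex.real_smul]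
    push_cast
    rfl
  let P : FormalMultilinearSeries ℝ ℝ ℂ := fun k => ContinuousMultilinearMap.mkPiRing ℝ (Fin k) (a k)
  have hcoeff : ∀ k, P.coeff k = a k := fun k => by
    simp [P, FormalMultilinearSeries.coeff]
  have hP : HasFPowerSeriesAt (0 : ℝ → ℂ) P 0 := by
    rw [hasFPowerSeriesAt_iff]
    refine Filter.Eventually.of_forall fun s => ?_
    simpa [hcoeff] using hsum s
  have h0 := hP.eq_zero
  have := hcoeff j
  rw [h0] at this
  simpa [FormalMultilinearSeries.coeff] using this.symm

/-- The degree `j` term of the exponential sum `∑ v ∈ V, c v * e_v`. -/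
def expSumTerm (V : Finset (Fin n → ℝ)) (c : (Fin n → ℝ) → ℂ) (j : ℕ) : Poly n :=
  ∑ v ∈ V, c v • expTerm j v

theorem pairing_expSumTerm (V : Finset (Fin n → ℝ)) (c : (Fin n → ℝ) → ℂ) (j : ℕ) (p : Poly n) :
    pairing n p (expSumTerm V c j) = ∑ v ∈ V, c v * evalReal v (homogeneousComponent j p) := by
  simp [expSumTerm, pairing_expTerm]

theorem isHomogeneousExpansion_expSum (V : Finset (Fin n → ℝ)) (c : (Fin n → ℝ) → ℂ) :
    IsHomogeneousExpansion (∑ v ∈ V, c v • expFun v) (expSumTerm V c) := by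
  constructor
  · intro j
    refine IsHomogeneous.sum _ _ _ fun v _ => ?_
    rw [smul_eq_C_mul]
    simpa using (isHomogeneous_C (Fin n) (c v)).mul (isHomogeneous_expTerm j v)
  · intro t
    simp only [← evalReal_eq_eval, expSumTerm, map_sum, map_smul, Finset.sum_apply, Pi.smul_apply]
    exact hasSum_sum fun v _ => (hasSum_expTerm v t).const_smul (c v)

theorem mem_expSpace_finset {V : Finset (Fin n → ℝ)} {f : (Fin n → ℝ) → ℂ} :
    f ∈ expSpace (V : Set (Fin n → ℝ)) ↔ ∃ c : (Fin n → ℝ) → ℂ, f = ∑ v ∈ V, c v • expFun v := by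
  rw [expSpace, Submodule.mem_span_image_finset_iff_exists_fun]
  constructor
  · rintro ⟨c, hc⟩
    classical
    refine ⟨fun v => if h : v ∈ V then c ⟨v, h⟩ else 0, ?_⟩
    rw [← hc, ← Finset.sum_attach V]
    refine Finset.sum_congr rfl fun v _ => ?_
    simp
  · rintro ⟨c, rfl⟩
    exact ⟨fun v => c v, V.sum_attach fun v => c v • expFun v⟩

theorem sum_evalReal_eq_sum_pairing (V : Finset (Fin n → ℝ)) (c : (Fin n → ℝ) → ℂ) (p : Poly n) :
    ∑ v ∈ V, c v * evalReal v p =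
      ∑ i ∈ Finset.range (p.totalDegree + 1), pairing n p (expSumTerm V c i) := by
  simp_rw [pairing_expSumTerm]
  rw [Finset.sum_comm]
  refine Finset.sum_congr rfl fun v _ => ?_
  rw [← Finset.mul_sum, ← map_sum, sum_homogeneousComponent]

theorem IsLeadingForm.homogeneousComponent_eq {d : ℕ} {g P : Poly n} (h : IsLeadingForm d g P)
    {j : ℕ} (hj : d ≤ j) : homogeneousComponent j P = homogeneousComponent j g := by
  classical
  rw [← sub_eq_zero, ← map_sub]
  ext m
  rw [coeff_homogeneousComponent, coeff_zero]
  split_ifs with hm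
  · exact h.2 m (by omega)
  · rfl

/-- Pair `P` with the whole exponential sum: the result is `∑ c_v P(v) = 0`. In the case `j = d`,
terms of the sum below `j` vanish and `P` has nothing above degree `d`, so only `⟨g, f_j⟩` survives.
-/
theorem pairing_leadingForm_eq_zero {V : Finset (Fin n → ℝ)} {c : (Fin n → ℝ) → ℂ} {d j : ℕ}
    {g P : Poly n} (h : IsLeadingForm d g P) (hP : ∀ v ∈ V, evalReal v P = 0)
    (hj : ∀ i < j, expSumTerm V c i = 0) : pairing n g (expSumTerm V c j) = 0 := by
  by_cases hdj : j = d
  · subst hdj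
    have h0 : pairing n g (expSumTerm V c j) = pairing n P (expSumTerm V c j) := by
      rw [pairing_expSumTerm, pairing_expSumTerm, h.homogeneousComponent_eq le_rfl]
    rw [h0]
    have h1 : ∑ v ∈ V, c v * evalReal v P = 0 :=
      Finset.sum_eq_zero fun v hv => by rw [hP v hv, mul_zero]
    rw [sum_evalReal_eq_sum_pairing, Finset.sum_eq_single j] at h1
    · exact h1
    · intro i _ hi
      rcases lt_or_gt_of_ne hi with hlt | hgt
      · rw [hj i hlt, map_zero]
      · rw [pairing_expSumTerm, h.homogeneousComponent_eq hgt.le,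
          homogeneousComponent_of_mem (m := i) h.1, if_neg (by omega)]
        simp
    · intro hjr
      rw [pairing_expSumTerm, homogeneousComponent_eq_zero _ _ (by
        simpa using hjr)]
      simp
  · rw [pairing_expSumTerm, homogeneousComponent_of_mem (m := j) h.1, if_neg hdj]
    simp

/-- If every generator of an ideal is the leading form of a polynomial that vanishes on `V`, then
the least space of `V` lies in the kernel of the ideal. -/
theorem leastSpace_le_idealKer (V : Finset (Fin n → ℝ)) (G : Set (Poly n))
    (hG : ∀ g ∈ G, ∃ d P, IsLeadingForm d g P ∧ ∀ v ∈ V, evalReal v P = 0) :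
    leastSpace (V : Set (Fin n → ℝ)) ≤ idealKer (Ideal.span G) := by
  rw [leastSpace, Submodule.span_le]
  rintro q ⟨f, hf, -, F, hF, j, -, hlow, rfl⟩
  obtain ⟨c, rfl⟩ := mem_expSpace_finset.1 hf
  obtain rfl := hF.unique (isHomogeneousExpansion_expSum V c)
  rw [SetLike.mem_coe, mem_idealKer_iff]
  intro p hp
  -- The multiplier `r` makes the claim stable under the ideal operations. A monomial times a
  -- generator is again the leading form of a polynomial vanishing on `V`.
  have key : ∀ r, pairing n (r * p) (expSumTerm V c j) = 0 := by
    induction hp using Submodule.span_induction with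
    | mem g hg =>
      intro r
      obtain ⟨d, P, hlead, hP⟩ := hG g hg
      rw [r.as_sum, Finset.sum_mul, map_sum, LinearMap.sum_apply]
      refine Finset.sum_eq_zero fun m _ => ?_
      have hm : IsLeadingForm m.degree (monomial m (coeff m r)) (monomial m (coeff m r)) :=
        ⟨isHomogeneous_monomial _ rfl, fun k _ => by simp⟩
      exact pairing_leadingForm_eq_zero (hm.mul hlead)
        (fun v hv => by rw [map_mul, hP v hv, mul_zero]) hlow
    | zero => simp
    | add x y _ _ hx hy => simp [mul_add, hx, hy]
    | smul a x _ hx =>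
      intro r
      rw [smul_eq_mul, ← mul_assoc, hx]
  simpa using key 1

/-- Distinct exponentials are independent: pairing the sum with a polynomial that vanishes on `V`
except at `v₀` isolates `c v₀`. -/
theorem exists_expSumTerm_ne_zero {V : Finset (Fin n → ℝ)} {c : (Fin n → ℝ) → ℂ}
    {v₀ : Fin n → ℝ} (hv₀ : v₀ ∈ V) (hc : c v₀ ≠ 0) : ∃ j, expSumTerm V c j ≠ 0 := by
  classical
  by_contra! hall
  -- The factor of `w` is `(v₀ - w) · (t - w)`: zero at `w`, and `|v₀ - w|² ≠ 0` at `v₀`.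
  let p : Poly n := ∏ w ∈ V.erase v₀, (linForm (v₀ - w) - C (((v₀ - w) ⬝ᵥ w : ℝ) : ℂ))
  have hp : ∀ v, evalReal v p = ∏ w ∈ V.erase v₀, (((v₀ - w) ⬝ᵥ (v - w) : ℝ) : ℂ) := by
    intro v
    rw [map_prod]
    refine Finset.prod_congr rfl fun w _ => ?_
    rw [map_sub, evalReal_linForm, dotProduct_sub]
    simp [evalReal]
  have h := sum_evalReal_eq_sum_pairing V c p
  rw [Finset.sum_eq_zero (s := Finset.range _) fun i _ => by rw [hall, map_zero],
    Finset.sum_eq_single v₀ _ (fun h => absurd hv₀ h)] at h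
  · rw [hp] at h
    rcases mul_eq_zero.1 h with h | h
    · exact hc h
    · obtain ⟨w, hw, h⟩ := Finset.prod_eq_zero_iff.1 h
      rw [Complex.ofReal_eq_zero, dotProduct_self_eq_zero, sub_eq_zero] at h
      exact (Finset.mem_erase.1 hw).1 h.symm
  · intro v hv hne
    rw [hp, Finset.prod_eq_zero (Finset.mem_erase.2 ⟨hne, hv⟩), mul_zero]
    simp

theorem expSumTerm_mem_leastSpace {V : Finset (Fin n → ℝ)} {c : (Fin n → ℝ) → ℂ} {j : ℕ}
    (hj : expSumTerm V c j ≠ 0) (hlow : ∀ i < j, expSumTerm V c i = 0) :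
    expSumTerm V c j ∈ leastSpace (V : Set (Fin n → ℝ)) := by
  refine Submodule.subset_span ⟨∑ v ∈ V, c v • expFun v, mem_expSpace_finset.2 ⟨c, rfl⟩, ?_,
    expSumTerm V c, isHomogeneousExpansion_expSum V c, j, hj, hlow, rfl⟩
  intro h0
  have hexp := isHomogeneousExpansion_expSum V c
  rw [h0] at hexp
  have hz : IsHomogeneousExpansion (0 : (Fin n → ℝ) → ℂ) (fun _ => 0) :=
    ⟨fun k => isHomogeneous_zero _ _ _, fun t => by simp [hasSum_zero]⟩
  exact hj (congrFun (hexp.unique hz) j)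

/-- Evaluation on `V` maps the least space of `V` onto the functions on `V`. -/
theorem leastSpace_eval_surjective (V : Finset (Fin n → ℝ)) :
    Function.Surjective ((LinearMap.pi fun v : V => (evalReal v.1).toLinearMap).domRestrict
      (leastSpace (V : Set (Fin n → ℝ)))) := by
  classical
  rw [← LinearMap.range_eq_top]
  by_contra hne
  obtain ⟨φ, hφ, hle⟩ := Submodule.exists_le_ker_of_lt_top _ (lt_top_iff_ne_top.2 hne)
  -- With conjugated coefficients, pairing the least term of `∑ c_v e_v` with its own conjugate
  -- gives the conjugate of `φ` on the values of that term. This is zero, since `φ` kills the image,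
  -- against positivity.
  let c : (Fin n → ℝ) → ℂ := fun v =>
    if h : v ∈ V then starRingEnd ℂ (φ (Pi.single ⟨v, h⟩ 1)) else 0
  have hsum : ∀ g : V → ℂ, φ g = ∑ v : V, starRingEnd ℂ (c v) * g v := by
    intro g
    conv_lhs => rw [← Finset.univ_sum_single g]
    rw [map_sum]
    refine Finset.sum_congr rfl fun v _ => ?_
    have : (Pi.single v (g v) : V → ℂ) = g v • Pi.single v 1 := by
      rw [← Pi.single_smul, smul_eq_mul, mul_one]
    rw [this, map_smul, smul_eq_mul, mul_comm]
    simp [c]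
  obtain ⟨v₀, hv₀⟩ : ∃ v₀ : V, c v₀ ≠ 0 := by
    by_contra! h
    apply hφ
    refine LinearMap.ext fun g => ?_
    rw [hsum]
    simp [h]
  have hex := exists_expSumTerm_ne_zero v₀.2 hv₀
  let j := Nat.find hex
  have hj : expSumTerm V c j ≠ 0 := Nat.find_spec hex
  have hlow : ∀ i < j, expSumTerm V c i = 0 := fun i hi => not_not.1 (Nat.find_min hex hi)
  have hmem := expSumTerm_mem_leastSpace hj hlow
  have h0 : φ (fun v : V => evalReal v.1 (expSumTerm V c j)) = 0 :=
    hle ⟨⟨_, hmem⟩, rfl⟩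
  rw [hsum] at h0
  apply pairing_conjPoly_self_ne_zero hj
  have hhom : (conjPoly (expSumTerm V c j)).IsHomogeneous j :=
    ((isHomogeneousExpansion_expSum V c).1 j).map _
  rw [pairing_expSumTerm, homogeneousComponent_of_mem (m := j) hhom, if_pos rfl,
    ← Finset.sum_coe_sort]
  have h1 := congrArg (starRingEnd ℂ) h0
  rw [map_sum, map_zero] at h1
  rw [← h1]
  refine Finset.sum_congr rfl fun v _ => ?_
  rw [map_mul, Complex.conj_conj, evalReal_eq_eval, evalReal_eq_eval, eval_conjPoly]

theorem card_le_finrank_leastSpace (V : Finset (Fin n → ℝ))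
    [Module.Finite ℂ (leastSpace (V : Set (Fin n → ℝ)))] :
    V.card ≤ Module.finrank ℂ (leastSpace (V : Set (Fin n → ℝ))) := by
  have := LinearMap.finrank_le_finrank_of_surjective (leastSpace_eval_surjective V)
  simpa using this

end Exponentials

/-! ### Directional derivatives and restriction to lines. -/

section Directional

variable {n : ℕ}

/-- The directional derivative along `η`. -/
def dirDeriv (η : Fin n → ℝ) : Derivation ℂ (Poly n) (Poly n) :=
  mkDerivation ℂ fun k => C (η k : ℂ)

/-- The directional derivative along `η`, as an endomorphism. -/
def dirEnd (η : Fin n → ℝ) : Module.End ℂ (Poly n) :=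
  (dirDeriv η : Poly n →ₗ[ℂ] Poly n)

theorem dirEnd_mul (η : Fin n → ℝ) (p q : Poly n) :
    dirEnd η (p * q) = p * dirEnd η q + q * dirEnd η p :=
  (dirDeriv η).leibniz p q

theorem dirEnd_C (η : Fin n → ℝ) (c : ℂ) : dirEnd η (C c) = 0 := (dirDeriv η).map_algebraMap c

theorem dirEnd_X (η : Fin n → ℝ) (i : Fin n) : dirEnd η (X i) = C (η i : ℂ) :=
  mkDerivation_X _ _ _

theorem dirEnd_linForm (η x : Fin n → ℝ) : dirEnd η (linForm x) = C ((x ⬝ᵥ η : ℝ) : ℂ) := by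
  simp [linForm, dirEnd_mul, dirEnd_X, dirEnd_C, dotProduct]

theorem dirEnd_C_mul (η : Fin n → ℝ) (c : ℂ) (p : Poly n) :
    dirEnd η (C c * p) = C c * dirEnd η p := by
  rw [dirEnd_mul, dirEnd_C, mul_zero, add_zero]

theorem dirEnd_smul (s : ℝ) (η : Fin n → ℝ) : dirEnd (s • η) = (s : ℂ) • dirEnd η := by
  have : dirDeriv (s • η) = (s : ℂ) • dirDeriv η := by
    apply MvPolynomial.derivation_ext
    intro i
    simp [dirDeriv, mkDerivation_X, smul_eq_C_mul]
  exact congrArg (fun d : Derivation ℂ (Poly n) (Poly n) => (d : Poly n →ₗ[ℂ] Poly n)) this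

theorem dirEnd_pow_succ_linForm_mul (η x : Fin n → ℝ) (k : ℕ) (q : Poly n) :
    (dirEnd η ^ (k + 1)) (linForm x * q) = linForm x * (dirEnd η ^ (k + 1)) q +
      C ((k + 1) * ((x ⬝ᵥ η : ℝ) : ℂ)) * (dirEnd η ^ k) q := by
  induction k with
  | zero =>
    simp [dirEnd_mul, dirEnd_linForm, mul_comm, add_comm]
  | succ k ih =>
    rw [pow_succ', Module.End.mul_apply, ih, map_add, dirEnd_mul, dirEnd_linForm, dirEnd_C_mul,
      ← Module.End.mul_apply, ← pow_succ', ← Module.End.mul_apply, ← pow_succ']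
    push_cast
    simp only [map_add, map_mul, map_one]
    ring

theorem dirEnd_pow_linForm_mul_of_dotProduct_eq_zero {η x : Fin n → ℝ} (h : x ⬝ᵥ η = 0) (k : ℕ)
    (q : Poly n) : (dirEnd η ^ k) (linForm x * q) = linForm x * (dirEnd η ^ k) q := by
  cases k with
  | zero => simp
  | succ k =>
    rw [dirEnd_pow_succ_linForm_mul, h]
    simp

theorem dirEnd_pow_eq_zero_of_le {η : Fin n → ℝ} {k l : ℕ} (hkl : k ≤ l) {p : Poly n}
    (h : (dirEnd η ^ k) p = 0) : (dirEnd η ^ l) p = 0 := by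
  obtain ⟨m, rfl⟩ := Nat.exists_eq_add_of_le' hkl
  rw [pow_add, Module.End.mul_apply, h, map_zero]

theorem exists_dirEnd_pow_eq_zero (η : Fin n → ℝ) (p : Poly n) : ∃ k, (dirEnd η ^ k) p = 0 := by
  induction p using MvPolynomial.induction_on with
  | C a => exact ⟨1, by rw [pow_one, dirEnd_C]⟩
  | add p q hp hq =>
    obtain ⟨k, hk⟩ := hp
    obtain ⟨l, hl⟩ := hq
    refine ⟨max k l, ?_⟩
    rw [map_add, dirEnd_pow_eq_zero_of_le (le_max_left k l) hk,
      dirEnd_pow_eq_zero_of_le (le_max_right k l) hl, add_zero]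
  | mul_X p i ih =>
    obtain ⟨k, hk⟩ := ih
    refine ⟨k + 1, ?_⟩
    rw [mul_comm, ← linForm_single, dirEnd_pow_succ_linForm_mul, hk,
      dirEnd_pow_eq_zero_of_le k.le_succ hk, mul_zero, mul_zero, add_zero]

/-- The restriction of a polynomial to the line `s ↦ a + s η`. -/
def lineMap (a η : Fin n → ℝ) : Poly n →ₐ[ℂ] Polynomial ℂ :=
  aeval fun i => Polynomial.C (a i : ℂ) + Polynomial.C (η i : ℂ) * Polynomial.X

theorem eval_lineMap (a η : Fin n → ℝ) (s : ℝ) (p : Poly n) :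
    (lineMap a η p).eval (s : ℂ) = evalReal (a + s • η) p := by
  have : (Polynomial.aeval (s : ℂ)).comp (lineMap a η) = evalReal (a + s • η) := by
    apply MvPolynomial.algHom_ext
    intro i
    simp only [lineMap, evalReal, AlgHom.comp_apply, aeval_X]
    simp only [map_add, map_mul, Polynomial.aeval_C, Polynomial.aeval_X, Pi.add_apply,
      Pi.smul_apply, smul_eq_mul, Complex.ofReal_add, Complex.ofReal_mul]
    simp only [Algebra.algebraMap_self, RingHom.id_apply]
    ring
  rw [← this]
  simp

theorem derivative_lineMap (a η : Fin n → ℝ) (p : Poly n) :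
    Polynomial.derivative (lineMap a η p) = lineMap a η (dirEnd η p) := by
  induction p using MvPolynomial.induction_on with
  | C c =>
    rw [dirEnd_C, map_zero]
    have : lineMap a η (C c) = Polynomial.C c := (lineMap a η).commutes c
    rw [this, Polynomial.derivative_C]
  | add p q hp hq => simp [hp, hq]
  | mul_X p i ih =>
    have hC : lineMap a η (C (η i : ℂ)) = Polynomial.C (η i : ℂ) := (lineMap a η).commutes _
    have hX : lineMap a η (X i) =
        Polynomial.C (a i : ℂ) + Polynomial.C (η i : ℂ) * Polynomial.X := by simp [lineMap]
    rw [map_mul, Polynomial.derivative_mul, ih, dirEnd_mul, dirEnd_X, map_add, map_mul, map_mul,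
      hC, hX]
    simp only [Polynomial.derivative_add, Polynomial.derivative_C, Polynomial.derivative_C_mul,
      Polynomial.derivative_X]
    ring

theorem polynomial_eq_zero_of_eval_real {P : Polynomial ℂ} (h : ∀ s : ℝ, P.eval (s : ℂ) = 0) :
    P = 0 := by
  apply Polynomial.eq_zero_of_infinite_isRoot
  refine (Set.infinite_range_of_injective Complex.ofReal_injective).mono ?_
  rintro _ ⟨s, rfl⟩
  exact h s

end Directional

/-! ### Ideals of linear subspaces. -/

section Vanishing

variable {n : ℕ}

/-- The orthogonal complement with respect to the dot product. -/
def perp (W : Submodule ℝ (Fin n → ℝ)) : Submodule ℝ (Fin n → ℝ) where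
  carrier := {a | ∀ w ∈ W, w ⬝ᵥ a = 0}
  add_mem' ha hb w hw := by rw [dotProduct_add, ha w hw, hb w hw, add_zero]
  zero_mem' w _ := dotProduct_zero w
  smul_mem' c a ha w hw := by rw [dotProduct_smul, ha w hw, smul_zero]

theorem perp_anti {W W' : Submodule ℝ (Fin n → ℝ)} (h : W ≤ W') : perp W' ≤ perp W :=
  fun _ ha w hw => ha w (h hw)

theorem mem_perp_span {s : Set (Fin n → ℝ)} {a : Fin n → ℝ} :
    a ∈ perp (Submodule.span ℝ s) ↔ ∀ w ∈ s, w ⬝ᵥ a = 0 := by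
  refine ⟨fun h w hw => h w (Submodule.subset_span hw), fun h w hw => ?_⟩
  induction hw using Submodule.span_induction with
  | mem w hw => exact h w hw
  | zero => exact zero_dotProduct a
  | add x y _ _ hx hy => rw [add_dotProduct, hx, hy, add_zero]
  | smul c x _ hx => rw [smul_dotProduct, hx, smul_zero]

theorem mem_perp_sup {W W' : Submodule ℝ (Fin n → ℝ)} {a : Fin n → ℝ} :
    a ∈ perp (W ⊔ W') ↔ a ∈ perp W ∧ a ∈ perp W' := by
  refine ⟨fun h => ⟨perp_anti le_sup_left h, perp_anti le_sup_right h⟩, fun h w hw => ?_⟩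
  obtain ⟨y, hy, z, hz, rfl⟩ := Submodule.mem_sup.1 hw
  rw [add_dotProduct, h.1 y hy, h.2 z hz, add_zero]

theorem mem_perp_span_singleton {x a : Fin n → ℝ} :
    a ∈ perp (Submodule.span ℝ {x}) ↔ x ⬝ᵥ a = 0 := by
  rw [mem_perp_span]
  simp

theorem exists_mem_perp {W : Submodule ℝ (Fin n → ℝ)} {x : Fin n → ℝ} (hx : x ∉ W) :
    ∃ a ∈ perp W, x ⬝ᵥ a = 1 := by
  obtain ⟨f, hfx, hf⟩ := Submodule.exists_le_ker_of_notMem hx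
  have hrep : ∀ v, f v = v ⬝ᵥ fun i => f (Pi.single i 1) := by
    intro v
    conv_lhs => rw [pi_eq_sum_univ' v]
    simp [dotProduct]
  refine ⟨(f x)⁻¹ • fun i => f (Pi.single i 1), ?_, ?_⟩
  · intro w hw
    rw [dotProduct_smul, ← hrep, show f w = 0 from hf hw, smul_zero]
  · rw [dotProduct_smul, ← hrep, smul_eq_mul, inv_mul_cancel₀ hfx]

/-- The ideal of the polynomials that vanish on the real points of `W^⊥`. -/
def vanishing (W : Submodule ℝ (Fin n → ℝ)) : Ideal (Poly n) where
  carrier := {p | ∀ a ∈ perp W, evalReal a p = 0}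
  add_mem' hp hq a ha := by rw [map_add, hp a ha, hq a ha, add_zero]
  zero_mem' a _ := map_zero _
  smul_mem' c p hp a ha := by rw [smul_eq_mul, map_mul, hp a ha, mul_zero]

theorem mem_vanishing {W : Submodule ℝ (Fin n → ℝ)} {p : Poly n} :
    p ∈ vanishing W ↔ ∀ a ∈ perp W, evalReal a p = 0 := Iff.rfl

theorem vanishing_mono {W W' : Submodule ℝ (Fin n → ℝ)} (h : W ≤ W') :
    vanishing W ≤ vanishing W' := fun _ hp a ha => hp a (perp_anti h ha)

theorem linForm_mem_vanishing {W : Submodule ℝ (Fin n → ℝ)} {w : Fin n → ℝ} (hw : w ∈ W) :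
    linForm w ∈ vanishing W := fun a ha => by rw [evalReal_linForm, ha w hw, Complex.ofReal_zero]

theorem linForm_notMem_vanishing {W : Submodule ℝ (Fin n → ℝ)} {x : Fin n → ℝ} (hx : x ∉ W) :
    linForm x ∉ vanishing W := by
  obtain ⟨a, ha, hxa⟩ := exists_mem_perp hx
  intro h
  have := h a ha
  rw [evalReal_linForm, hxa] at this
  simp at this

theorem lineMap_eq_zero {W : Submodule ℝ (Fin n → ℝ)} {p : Poly n} (hp : p ∈ vanishing W)
    {a η : Fin n → ℝ} (ha : a ∈ perp W) (hη : η ∈ perp W) : lineMap a η p = 0 :=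
  polynomial_eq_zero_of_eval_real fun s => by
    rw [eval_lineMap]
    exact hp _ (add_mem ha (Submodule.smul_mem _ _ hη))

/-- A point of `W^⊥` with `p ≠ 0` and one with `q ≠ 0` are joined by a line inside `W^⊥`, on which
`p q` is a product of nonzero univariate polynomials. -/
theorem mem_or_mem_of_mul_mem_vanishing {W : Submodule ℝ (Fin n → ℝ)} {p q : Poly n}
    (h : p * q ∈ vanishing W) : p ∈ vanishing W ∨ q ∈ vanishing W := by
  by_contra! hpq
  obtain ⟨hp, hq⟩ := hpq
  simp only [mem_vanishing, not_forall] at hp hq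
  obtain ⟨a, ha, hpa⟩ := hp
  obtain ⟨b, hb, hqb⟩ := hq
  have h0 := lineMap_eq_zero h ha (sub_mem hb ha)
  rw [map_mul] at h0
  rcases mul_eq_zero.1 h0 with h0 | h0
  · have := eval_lineMap a (b - a) 0 p
    rw [h0] at this
    apply hpa
    simpa using this.symm
  · have := eval_lineMap a (b - a) 1 q
    rw [h0] at this
    apply hqb
    simpa using this.symm

theorem dirEnd_mem_vanishing {W : Submodule ℝ (Fin n → ℝ)} {η : Fin n → ℝ} (hη : η ∈ perp W)
    {p : Poly n} (hp : p ∈ vanishing W) : dirEnd η p ∈ vanishing W := by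
  intro a ha
  have h0 := lineMap_eq_zero hp ha hη
  have h1 := derivative_lineMap a η p
  rw [h0, Polynomial.derivative_zero] at h1
  have := eval_lineMap a η 0 (dirEnd η p)
  rw [← h1] at this
  simpa using this.symm

theorem dirEnd_pow_mem_vanishing {W : Submodule ℝ (Fin n → ℝ)} {η : Fin n → ℝ} (hη : η ∈ perp W)
    (k : ℕ) {p : Poly n} (hp : p ∈ vanishing W) : (dirEnd η ^ k) p ∈ vanishing W := by
  induction k with
  | zero => exact hp
  | succ k ih =>
    rw [pow_succ', Module.End.mul_apply]
    exact dirEnd_mem_vanishing hη ih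

theorem dirEnd_pow_mem_vanishing_of_le {W : Submodule ℝ (Fin n → ℝ)} {η : Fin n → ℝ}
    (hη : η ∈ perp W) {k l : ℕ} (hkl : k ≤ l) {p : Poly n}
    (hp : (dirEnd η ^ k) p ∈ vanishing W) : (dirEnd η ^ l) p ∈ vanishing W := by
  obtain ⟨m, rfl⟩ := Nat.exists_eq_add_of_le' hkl
  rw [pow_add, Module.End.mul_apply]
  exact dirEnd_pow_mem_vanishing hη m hp

/-- A product `p_x q` has larger degree along `η` than `q`, if `x · η ≠ 0`. -/
theorem dirEnd_pow_sub_one_mem_vanishing {W : Submodule ℝ (Fin n → ℝ)} {η x : Fin n → ℝ}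
    (hη : η ∈ perp W) (hx : x ⬝ᵥ η ≠ 0) {m : ℕ} {q : Poly n}
    (h : (dirEnd η ^ m) (linForm x * q) ∈ vanishing W) :
    (dirEnd η ^ (m - 1)) q ∈ vanishing W := by
  classical
  -- If the least such order were `k + 1 > m - 1`, the Leibniz formula at order `k + 1` would leave
  -- a nonzero multiple of the `k`-th derivative of `q`, contrary to minimality.
  have hex : ∃ k, (dirEnd η ^ k) q ∈ vanishing W := by
    obtain ⟨k, hk⟩ := exists_dirEnd_pow_eq_zero η q
    exact ⟨k, hk ▸ zero_mem _⟩
  have hspec := Nat.find_spec hex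
  by_cases hk : Nat.find hex ≤ m - 1
  · exact dirEnd_pow_mem_vanishing_of_le hη hk hspec
  exfalso
  obtain ⟨k, hk'⟩ : ∃ k, Nat.find hex = k + 1 := ⟨Nat.find hex - 1, by omega⟩
  rw [hk'] at hspec hk
  have h1 : (dirEnd η ^ (k + 1)) (linForm x * q) ∈ vanishing W :=
    dirEnd_pow_mem_vanishing_of_le hη (by omega) h
  rw [dirEnd_pow_succ_linForm_mul] at h1
  have h2 := ((vanishing W).add_mem_iff_right ((vanishing W).mul_mem_left _ hspec)).1 h1
  have hc : ((k + 1) * ((x ⬝ᵥ η : ℝ) : ℂ)) ≠ 0 :=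
    mul_ne_zero (by exact_mod_cast k.succ_ne_zero) (by exact_mod_cast hx)
  have h3 := (vanishing W).mul_mem_left (C ((k + 1) * ((x ⬝ᵥ η : ℝ) : ℂ))⁻¹) h2
  rw [← mul_assoc, ← C_mul, inv_mul_cancel₀ hc, C_1, one_mul] at h3
  exact Nat.find_min hex (by omega) h3

theorem eq_zero_of_mem_vanishing_bot {p : Poly n}
    (h : p ∈ vanishing (⊥ : Submodule ℝ (Fin n → ℝ))) : p = 0 :=
  eq_zero_of_evalReal_eq_zero fun v => h v fun w hw => by
    rw [(Submodule.mem_bot ℝ).1 hw, zero_dotProduct]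

theorem perp_top : perp (⊤ : Submodule ℝ (Fin n → ℝ)) = ⊥ := by
  rw [eq_bot_iff]
  intro a ha
  exact dotProduct_self_eq_zero.1 (ha a trivial)

/-- A polynomial that is constant along `η` and vanishes on a complement of `η` is zero. -/
theorem eq_zero_of_dirEnd_eq_zero {c η : Fin n → ℝ} (hc : c ⬝ᵥ η ≠ 0) {p : Poly n}
    (hD : dirEnd η p = 0) (hp : p ∈ vanishing (Submodule.span ℝ {c})) : p = 0 := by
  refine eq_zero_of_evalReal_eq_zero fun t => ?_
  set s : ℝ := (c ⬝ᵥ t) / (c ⬝ᵥ η) with hs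
  have ha : t - s • η ∈ perp (Submodule.span ℝ {c}) := by
    rw [mem_perp_span_singleton, dotProduct_sub, dotProduct_smul, smul_eq_mul, hs,
      div_mul_cancel₀ _ hc, sub_self]
  have h1 := derivative_lineMap (t - s • η) η p
  rw [hD, map_zero] at h1
  have h2 := Polynomial.eq_C_of_derivative_eq_zero h1
  have h3 := eval_lineMap (t - s • η) η s p
  have h4 := eval_lineMap (t - s • η) η 0 p
  rw [h2, Polynomial.eval_C] at h3 h4
  rw [zero_smul, add_zero, hp _ ha] at h4
  rw [sub_add_cancel] at h3
  rw [← h3, h4]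

/-- A polynomial that vanishes on `W^⊥ ∩ x^⊥` is a multiple of `p_x` on `W^⊥`. -/
theorem exists_eq_linForm_mul_add {W : Submodule ℝ (Fin n → ℝ)} {x : Fin n → ℝ} {p : Poly n}
    (hp : p ∈ vanishing (W ⊔ Submodule.span ℝ {x})) :
    ∃ q, ∃ z ∈ vanishing W, p = linForm x * q + z := by
  by_cases hx : x ∈ W
  · rw [sup_eq_left.2 ((Submodule.span_singleton_le_iff_mem _ _).2 hx)] at hp
    exact ⟨0, p, hp, by simp⟩
  obtain ⟨a₀, ha₀, hxa⟩ := exists_mem_perp hx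
  -- Pullback along the projection `t ↦ t - (x · t) a₀` onto `x^⊥`; it changes a polynomial by a
  -- multiple of `p_x` only, and it preserves `W^⊥` because `a₀ ∈ W^⊥`.
  let φ : Poly n →ₐ[ℂ] Poly n := aeval fun i => X i - linForm x * C (a₀ i : ℂ)
  have hφ : ∀ p, p - φ p ∈ Ideal.span {linForm x} := by
    intro p
    rw [← Ideal.Quotient.eq]
    have : (Ideal.Quotient.mkₐ ℂ (Ideal.span {linForm x})).comp φ =
        Ideal.Quotient.mkₐ ℂ (Ideal.span {linForm x}) := by
      apply MvPolynomial.algHom_ext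
      intro i
      simp only [φ, AlgHom.comp_apply, aeval_X, Ideal.Quotient.mkₐ_eq_mk]
      rw [Ideal.Quotient.eq, sub_sub_cancel_left]
      exact neg_mem (Ideal.mul_mem_right _ _ (Ideal.mem_span_singleton_self _))
    exact (congrArg (fun f => f p) this).symm
  obtain ⟨q, hq⟩ := Ideal.mem_span_singleton'.1 (hφ p)
  refine ⟨q, φ p, ?_, by rw [mul_comm, hq, sub_add_cancel]⟩
  intro a ha
  have hcomp : (evalReal a).comp φ = evalReal (a - (x ⬝ᵥ a) • a₀) := by
    apply MvPolynomial.algHom_ext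
    intro i
    simp only [φ, AlgHom.comp_apply, aeval_X, map_sub, map_mul, evalReal_linForm]
    simp [evalReal]
  have : evalReal a (φ p) = evalReal (a - (x ⬝ᵥ a) • a₀) p := congrArg (fun f => f p) hcomp
  rw [this]
  refine hp _ (mem_perp_sup.2 ⟨sub_mem ha (Submodule.smul_mem _ _ ha₀), ?_⟩)
  rw [mem_perp_span_singleton, dotProduct_sub, dotProduct_smul, hxa, smul_eq_mul, mul_one, sub_self]

/-- Columns are split off one at a time by `exists_eq_linForm_mul_add`. The resulting generators are
leading forms, as `leastSpace_le_idealKer` requires. -/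
theorem vanishing_span_image {ι : Type*} (X : ι → Fin n → ℝ) (C : Finset ι) :
    vanishing (Submodule.span ℝ (X '' (C : Set ι))) =
      Ideal.span ((fun i => linForm (X i)) '' (C : Set ι)) := by
  classical
  apply le_antisymm
  · induction C using Finset.induction_on with
    | empty =>
      intro p hp
      simp only [Finset.coe_empty, Set.image_empty, Submodule.span_empty] at hp
      rw [eq_zero_of_mem_vanishing_bot hp]
      exact zero_mem _
    | insert a s _ ih =>
      intro p hp
      rw [Finset.coe_insert, Set.image_insert_eq, Submodule.span_insert, sup_comm] at hp
      obtain ⟨q, z, hz, rfl⟩ := exists_eq_linForm_mul_add hp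
      refine add_mem (Ideal.mul_mem_right _ _ (Ideal.subset_span ⟨a, by simp, rfl⟩)) ?_
      refine Ideal.span_mono (Set.image_mono ?_) (ih hz)
      simp
  · rw [Ideal.span_le]
    rintro _ ⟨i, hi, rfl⟩
    exact linForm_mem_vanishing (Submodule.subset_span ⟨i, hi, rfl⟩)

end Vanishing

/-! ### Codimension along a deletion-contraction sequence. -/

section Codimension

variable {K E : Type*} [Field K] [AddCommGroup E] [Module K E]

theorem finite_quotient_of_sup_span_eq_top {M : Submodule K E} {T : Finset E}
    (h : M ⊔ Submodule.span K (T : Set E) = ⊤) :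
    Module.Finite K (E ⧸ M) ∧ Module.finrank K (E ⧸ M) ≤ T.card := by
  classical
  have hspan : Submodule.span K ((T.image M.mkQ : Finset (E ⧸ M)) : Set (E ⧸ M)) = ⊤ := by
    rw [Finset.coe_image, Submodule.span_image]
    have := congrArg (Submodule.map M.mkQ) h
    rwa [Submodule.map_sup, Submodule.mkQ_map_self, bot_sup_eq, Submodule.map_top,
      Submodule.range_mkQ] at this
  refine ⟨⟨⟨_, hspan⟩⟩, ?_⟩
  rw [← finrank_top, ← hspan]
  exact (finrank_span_finset_le_card _).trans Finset.card_image_le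

theorem exists_sup_span_eq_top (M : Submodule K E) [Module.Finite K (E ⧸ M)] :
    ∃ T : Finset E, T.card ≤ Module.finrank K (E ⧸ M) ∧
      M ⊔ Submodule.span K (T : Set E) = ⊤ := by
  classical
  let b := Module.finBasis K (E ⧸ M)
  choose f hf using fun i => M.mkQ_surjective (b i)
  refine ⟨Finset.univ.image f, Finset.card_image_le.trans (by simp), ?_⟩
  have h1 : Submodule.map M.mkQ (M ⊔ Submodule.span K ((Finset.univ.image f : Finset E) : Set E))
      = ⊤ := by
    rw [Submodule.map_sup, Submodule.map_span, Finset.coe_image, Finset.coe_univ, Set.image_univ,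
      ← Set.range_comp, show (M.mkQ ∘ f) = b from funext hf, b.span_eq, sup_top_eq]
  have h2 := congrArg (Submodule.comap M.mkQ) h1
  rwa [Submodule.comap_map_eq, Submodule.ker_mkQ, Submodule.comap_top,
    sup_eq_left.2 le_sup_left] at h2

/-- Modulo `M`, the space is generated by the `f`-images of generators modulo `M₁` together with
generators modulo `M₂`. The sequence `E/M₁ → E/M → E/M₂` need not be exact. -/
theorem finrank_quotient_le_add {M M₁ M₂ : Submodule K E} [Module.Finite K (E ⧸ M₁)]
    [Module.Finite K (E ⧸ M₂)] (f : E →ₗ[K] E) (h₁ : ∀ q ∈ M₁, f q ∈ M)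
    (h₂ : ∀ q ∈ M₂, ∃ r, q - f r ∈ M) :
    Module.Finite K (E ⧸ M) ∧
      Module.finrank K (E ⧸ M) ≤ Module.finrank K (E ⧸ M₁) + Module.finrank K (E ⧸ M₂) := by
  classical
  obtain ⟨T₁, hc₁, hT₁⟩ := exists_sup_span_eq_top M₁
  obtain ⟨T₂, hc₂, hT₂⟩ := exists_sup_span_eq_top M₂
  have htop : M ⊔ Submodule.span K ((T₁.image f ∪ T₂ : Finset E) : Set E) = ⊤ := by
    rw [eq_top_iff]
    intro p _
    rw [Finset.coe_union, Finset.coe_image, Submodule.span_union, Submodule.span_image]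
    obtain ⟨q, hq, t₂, ht₂, rfl⟩ := Submodule.mem_sup.1 (hT₂ ▸ Submodule.mem_top : p ∈ _)
    obtain ⟨r, hr⟩ := h₂ q hq
    obtain ⟨s, hs, t₁, ht₁, hst⟩ :=
      Submodule.mem_sup.1 (hT₁ ▸ Submodule.mem_top : r ∈ _)
    have : q + t₂ = (q - f r + f s) + (f t₁ + t₂) := by
      rw [← hst, map_add]
      abel
    rw [this]
    exact Submodule.add_mem_sup (add_mem hr (h₁ s hs))
      (Submodule.add_mem_sup (Submodule.mem_map_of_mem ht₁) ht₂)
  obtain ⟨hfin, hle⟩ := finite_quotient_of_sup_span_eq_top htop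
  refine ⟨hfin, hle.trans ((Finset.card_union_le _ _).trans ?_)⟩
  exact add_le_add (Finset.card_image_le.trans hc₁) hc₂

theorem finrank_quotient_lt {M M' : Submodule K E} [Module.Finite K (E ⧸ M)] (h : M ≤ M') {q : E}
    (hq : q ∈ M') (hq' : q ∉ M) :
    Module.Finite K (E ⧸ M') ∧ Module.finrank K (E ⧸ M') < Module.finrank K (E ⧸ M) := by
  let g : (E ⧸ M) →ₗ[K] (E ⧸ M') := Submodule.factor h
  have hg : Function.Surjective g := Submodule.factor_surjective h
  have hfin : Module.Finite K (E ⧸ M') := Module.Finite.of_surjective g hg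
  refine ⟨hfin, ?_⟩
  have hrn := g.finrank_range_add_finrank_ker
  rw [LinearMap.range_eq_top.2 hg, finrank_top] at hrn
  have hker : 0 < Module.finrank K g.ker := by
    rw [Module.finrank_pos_iff_exists_ne_zero]
    refine ⟨⟨M.mkQ q, ?_⟩, ?_⟩
    · rw [LinearMap.mem_ker]
      simpa [g] using hq
    · rw [Ne, Submodule.mk_eq_zero]
      simpa using hq'
  omega

/-- If the bound `finrank_quotient_le_add` is sharp, then `M₁` is the preimage of `M`. -/
theorem mem_of_finrank_quotient_ge {M M₁ M₂ : Submodule K E} [Module.Finite K (E ⧸ M₁)]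
    [Module.Finite K (E ⧸ M₂)] (f : E →ₗ[K] E) (h₁ : ∀ q ∈ M₁, f q ∈ M)
    (h₂ : ∀ q ∈ M₂, ∃ r, q - f r ∈ M)
    (hge : Module.finrank K (E ⧸ M₁) + Module.finrank K (E ⧸ M₂) ≤ Module.finrank K (E ⧸ M))
    {q : E} (hq : f q ∈ M) : q ∈ M₁ := by
  by_contra hq'
  -- The bound also holds with the full preimage of `M` in place of `M₁`; a strictly larger preimage
  -- would make it strict.
  obtain ⟨hfin, hlt⟩ := finrank_quotient_lt (M := M₁) (M' := M.comap f) h₁ hq hq'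
  have := (finrank_quotient_le_add (M₁ := M.comap f) f (fun q hq => hq) h₂).2
  omega

end Codimension

/-! ### Internal bases under deletion and contraction. -/

section Minors

variable {n : ℕ} {ι : Type*}

/-- The span of the columns in `S`. -/
abbrev colSpan (X : ι → Fin n → ℝ) (S : Finset ι) : Submodule ℝ (Fin n → ℝ) :=
  Submodule.span ℝ (X '' (S : Set ι))

theorem colSpan_mono (X : ι → Fin n → ℝ) {S T : Finset ι} (h : S ⊆ T) :
    colSpan X S ≤ colSpan X T := Submodule.span_mono (Set.image_mono (by exact_mod_cast h))

theorem mem_colSpan (X : ι → Fin n → ℝ) {S : Finset ι} {i : ι} (hi : i ∈ S) :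
    X i ∈ colSpan X S := Submodule.subset_span ⟨i, hi, rfl⟩

theorem colSpan_insert [DecidableEq ι] (X : ι → Fin n → ℝ) (S : Finset ι) (i : ι) :
    colSpan X (insert i S) = Submodule.span ℝ {X i} ⊔ colSpan X S := by
  rw [colSpan, Finset.coe_insert, Set.image_insert_eq, Submodule.span_insert]

theorem colSpan_union [DecidableEq ι] (X : ι → Fin n → ℝ) (S T : Finset ι) :
    colSpan X (S ∪ T) = colSpan X S ⊔ colSpan X T := by
  rw [colSpan, Finset.coe_union, Set.image_union, Submodule.span_union]

theorem finrank_colSpan_le (X : ι → Fin n → ℝ) (S : Finset ι) :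
    Module.finrank ℝ (colSpan X S) ≤ S.card := by
  classical
  rw [colSpan, ← Finset.coe_image]
  exact (finrank_span_finset_le_card _).trans Finset.card_image_le

theorem finrank_sup_colSpan_le (X : ι → Fin n → ℝ) (W : Submodule ℝ (Fin n → ℝ)) (S : Finset ι) :
    Module.finrank ℝ (W ⊔ colSpan X S : Submodule ℝ (Fin n → ℝ)) ≤
      Module.finrank ℝ W + S.card :=
  (Submodule.finrank_add_le_finrank_add_finrank _ _).trans
    (Nat.add_le_add_left (finrank_colSpan_le X S) _)

theorem finrank_sup_span_singleton {W : Submodule ℝ (Fin n → ℝ)} {x : Fin n → ℝ} (hx : x ∉ W) :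
    Module.finrank ℝ (W ⊔ Submodule.span ℝ {x} : Submodule ℝ (Fin n → ℝ)) =
      Module.finrank ℝ W + 1 := by
  apply le_antisymm
  · refine (Submodule.finrank_add_le_finrank_add_finrank _ _).trans (Nat.add_le_add_left ?_ _)
    simpa using finrank_span_le_card (R := ℝ) ({x} : Set (Fin n → ℝ))
  · apply Submodule.finrank_lt_finrank_of_lt
    refine lt_of_le_of_ne le_sup_left fun h => hx ?_
    rw [h]
    exact Submodule.mem_sup_right (Submodule.mem_span_singleton_self x)

theorem eq_top_of_le_finrank {U : Submodule ℝ (Fin n → ℝ)} (h : n ≤ Module.finrank ℝ U) :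
    U = ⊤ := by
  apply Submodule.eq_top_of_finrank_eq
  apply le_antisymm (Submodule.finrank_le U)
  simpa using h

theorem finrank_lt_of_notMem {U : Submodule ℝ (Fin n → ℝ)} {x : Fin n → ℝ} (h : x ∉ U) :
    Module.finrank ℝ U < n := by
  by_contra! hn
  rw [eq_top_of_le_finrank hn] at h
  exact h trivial

theorem mem_sup_span_exchange {U : Submodule ℝ (Fin n → ℝ)} {x y : Fin n → ℝ}
    (h : x ∈ U ⊔ Submodule.span ℝ {y}) (hx : x ∉ U) : y ∈ U ⊔ Submodule.span ℝ {x} := by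
  obtain ⟨u, hu, z, hz, rfl⟩ := Submodule.mem_sup.1 h
  obtain ⟨c, rfl⟩ := Submodule.mem_span_singleton.1 hz
  have hc : c ≠ 0 := by
    rintro rfl
    simp [hu] at hx
  have : y = (-c⁻¹) • u + c⁻¹ • (u + c • y) := by
    rw [smul_add, smul_smul, inv_mul_cancel₀ hc, one_smul, neg_smul]
    abel
  have hmem : (-c⁻¹) • u + c⁻¹ • (u + c • y) ∈ U ⊔ Submodule.span ℝ {u + c • y} :=
    Submodule.add_mem_sup (U.smul_mem _ hu)
      (Submodule.smul_mem _ _ (Submodule.mem_span_singleton_self _))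
  rwa [← this] at hmem

variable [LinearOrder ι]

/-- `B ⊆ S` is a basis of the columns in `S` modulo `W`, and no element of `B ∩ I` is internally
active. -/
structure IsMinorBasis (X : ι → Fin n → ℝ) (I : Finset ι) (W : Submodule ℝ (Fin n → ℝ))
    (S B : Finset ι) : Prop where
  subset : B ⊆ S
  card_add : B.card + Module.finrank ℝ W = n
  sup_eq : W ⊔ colSpan X B = ⊤
  inactive : ∀ b ∈ B, b ∈ I → ∃ i ∈ S, b < i ∧ X i ∉ W ⊔ colSpan X (B.erase b)

/-- The finite set of the `I`-internal bases of a minor. -/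
def minorBases (X : ι → Fin n → ℝ) (I : Finset ι) (W : Submodule ℝ (Fin n → ℝ)) (S : Finset ι) :
    Finset (Finset ι) :=
  haveI := Classical.decPred (IsMinorBasis X I W S)
  S.powerset.filter (IsMinorBasis X I W S)

variable {X : ι → Fin n → ℝ} {I : Finset ι} {W : Submodule ℝ (Fin n → ℝ)} {S B : Finset ι} {x : ι}

theorem mem_minorBases : B ∈ minorBases X I W S ↔ IsMinorBasis X I W S B := by
  classical
  rw [minorBases, Finset.mem_filter, Finset.mem_powerset]
  exact ⟨fun h => h.2, fun h => ⟨h.subset, h⟩⟩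

theorem notMem_sup_colSpan_erase (hc : B.card + Module.finrank ℝ W = n)
    (hs : W ⊔ colSpan X B = ⊤) {b : ι} (hb : b ∈ B) : X b ∉ W ⊔ colSpan X (B.erase b) := by
  intro h
  have h1 : W ⊔ colSpan X (B.erase b) = ⊤ := by
    rw [eq_top_iff, ← hs, ← Finset.insert_erase hb, colSpan_insert]
    refine sup_le le_sup_left (sup_le ?_ ?_)
    · rw [Submodule.span_singleton_le_iff_mem]
      simpa using h
    · simp
  have h2 := finrank_sup_colSpan_le X W (B.erase b)
  rw [h1, finrank_top, Module.finrank_fin_fun, Finset.card_erase_of_mem hb] at h2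
  have := Finset.card_pos.2 ⟨b, hb⟩
  omega

theorem finrank_sup_colSpan_erase (hc : B.card + Module.finrank ℝ W = n)
    (hs : W ⊔ colSpan X B = ⊤) {b : ι} (hb : b ∈ B) :
    Module.finrank ℝ (W ⊔ colSpan X (B.erase b) : Submodule ℝ (Fin n → ℝ)) + 1 = n := by
  rw [← finrank_sup_span_singleton (notMem_sup_colSpan_erase hc hs hb), sup_assoc,
    sup_comm (colSpan X _), ← colSpan_insert, Finset.insert_erase hb, hs]
  simp

theorem sup_span_singleton_eq_top {U : Submodule ℝ (Fin n → ℝ)}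
    (hU : Module.finrank ℝ U + 1 = n) {y : Fin n → ℝ} (hy : y ∉ U) :
    U ⊔ Submodule.span ℝ {y} = ⊤ :=
  eq_top_of_le_finrank (by rw [finrank_sup_span_singleton hy, hU])

theorem IsMinorBasis.mono {S' : Finset ι} (h : IsMinorBasis X I W S B) (hS : S ⊆ S') :
    IsMinorBasis X I W S' B where
  subset := h.subset.trans hS
  card_add := h.card_add
  sup_eq := h.sup_eq
  inactive b hb hbI := by
    obtain ⟨i, hi, h'⟩ := h.inactive b hb hbI
    exact ⟨i, hS hi, h'⟩

theorem IsMinorBasis.of_insert_of_mem (h : IsMinorBasis X I W (insert x S) B) (hx : X x ∈ W) :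
    IsMinorBasis X I W S B where
  subset := by
    intro b hb
    refine (Finset.mem_insert.1 (h.subset hb)).resolve_left ?_
    rintro rfl
    exact notMem_sup_colSpan_erase h.card_add h.sup_eq hb (Submodule.mem_sup_left hx)
  card_add := h.card_add
  sup_eq := h.sup_eq
  inactive b hb hbI := by
    obtain ⟨i, hi, hlt, hni⟩ := h.inactive b hb hbI
    refine ⟨i, (Finset.mem_insert.1 hi).resolve_left ?_, hlt, hni⟩
    rintro rfl
    exact hni (Submodule.mem_sup_left hx)

/-- Such an `x` lies in every basis `B`, and modulo `W` the rest of `B` already spans all of `S`. No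
later column can then witness that `x` is inactive. -/
theorem not_isMinorBasis_of_coloop (hxI : x ∈ I) (hx : X x ∉ W ⊔ colSpan X S) :
    ¬ IsMinorBasis X I W (insert x S) B := by
  intro h
  have hxB : x ∈ B := by
    by_contra hxB
    have hBS : B ⊆ S := fun b hb =>
      (Finset.mem_insert.1 (h.subset hb)).resolve_left (by rintro rfl; exact hxB hb)
    exact hx (sup_le_sup_left (colSpan_mono X hBS) W (h.sup_eq.symm ▸ Submodule.mem_top))
  have hBS : B.erase x ⊆ S := fun b hb =>
    (Finset.mem_insert.1 (h.subset (Finset.mem_of_mem_erase hb))).resolve_left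
      (Finset.ne_of_mem_erase hb)
  have heq : W ⊔ colSpan X (B.erase x) = W ⊔ colSpan X S := by
    apply Submodule.eq_of_le_of_finrank_le (sup_le_sup_left (colSpan_mono X hBS) W)
    have h1 := finrank_sup_colSpan_erase h.card_add h.sup_eq hxB
    have h2 := finrank_lt_of_notMem hx
    omega
  obtain ⟨i, hi, hlt, hni⟩ := h.inactive x hxB hxI
  have hiS : i ∈ S := (Finset.mem_insert.1 hi).resolve_left hlt.ne'
  rw [heq] at hni
  exact hni (Submodule.mem_sup_right (mem_colSpan X hiS))

/-- A witness for `b` comes after `b`, so it is never the first column `x`. This is why columns are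
removed in increasing order. -/
theorem IsMinorBasis.delete (h : IsMinorBasis X I W (insert x S) B) (hmin : ∀ y ∈ S, x < y)
    (hxB : x ∉ B) : IsMinorBasis X I W S B where
  subset b hb := (Finset.mem_insert.1 (h.subset hb)).resolve_left (by rintro rfl; exact hxB hb)
  card_add := h.card_add
  sup_eq := h.sup_eq
  inactive b hb hbI := by
    obtain ⟨i, hi, hlt, hni⟩ := h.inactive b hb hbI
    refine ⟨i, (Finset.mem_insert.1 hi).resolve_left ?_, hlt, hni⟩
    rintro rfl
    have := (Finset.mem_insert.1 (h.subset hb)).resolve_left hlt.ne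
    exact lt_asymm hlt (hmin b this)

theorem IsMinorBasis.contract (h : IsMinorBasis X I W (insert x S) B) (hmin : ∀ y ∈ S, x < y)
    (hxB : x ∈ B) : IsMinorBasis X I (W ⊔ Submodule.span ℝ {X x}) S (B.erase x) := by
  have hxW : X x ∉ W := fun hx =>
    notMem_sup_colSpan_erase h.card_add h.sup_eq hxB (Submodule.mem_sup_left hx)
  have hsub : B.erase x ⊆ S := fun b hb =>
    (Finset.mem_insert.1 (h.subset (Finset.mem_of_mem_erase hb))).resolve_left
      (Finset.ne_of_mem_erase hb)
  refine ⟨hsub, ?_, ?_, ?_⟩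
  · rw [finrank_sup_span_singleton hxW, Finset.card_erase_of_mem hxB]
    have := Finset.card_pos.2 ⟨x, hxB⟩
    have := h.card_add
    omega
  · rw [sup_assoc, ← colSpan_insert, Finset.insert_erase hxB, h.sup_eq]
  · intro b hb hbI
    obtain ⟨i, hi, hlt, hni⟩ := h.inactive b (Finset.mem_of_mem_erase hb) hbI
    refine ⟨i, (Finset.mem_insert.1 hi).resolve_left ?_, hlt, ?_⟩
    · rintro rfl
      exact lt_asymm hlt (hmin b (hsub hb))
    · rwa [sup_assoc, ← colSpan_insert, Finset.erase_right_comm, Finset.insert_erase]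
      exact Finset.mem_erase.2 ⟨(Finset.ne_of_mem_erase hb).symm, hxB⟩

/-- Only `x` needs a new witness. If `x ∈ I` had none, all of `S`, and so `X x` by `hx`, would lie
in `W + span B`, whose dimension is less than `n`. -/
theorem IsMinorBasis.uncontract (h : IsMinorBasis X I (W ⊔ Submodule.span ℝ {X x}) S B)
    (hmin : ∀ y ∈ S, x < y) (hxW : X x ∉ W) (hx : x ∈ I → X x ∈ W ⊔ colSpan X S) :
    IsMinorBasis X I W (insert x S) (insert x B) := by
  have hxB : x ∉ B := fun hxB => lt_irrefl _ (hmin x (h.subset hxB))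
  have hcard := h.card_add
  rw [finrank_sup_span_singleton hxW] at hcard
  refine ⟨Finset.insert_subset_insert x h.subset, ?_, ?_, ?_⟩
  · rw [Finset.card_insert_of_notMem hxB]
    omega
  · rw [colSpan_insert, ← sup_assoc, h.sup_eq]
  · intro b hb hbI
    rcases Finset.mem_insert.1 hb with rfl | hb
    · rw [Finset.erase_insert hxB]
      by_contra! hall
      have h1 : colSpan X S ≤ W ⊔ colSpan X B := by
        rw [colSpan, Submodule.span_le]
        rintro _ ⟨i, hi, rfl⟩
        exact hall i (Finset.mem_insert_of_mem hi) (hmin i hi)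
      have h2 : X b ∈ W ⊔ colSpan X B := (sup_le le_sup_left h1) (hx hbI)
      have h3 : W ⊔ colSpan X B = ⊤ := by
        rw [eq_top_iff, ← h.sup_eq]
        refine sup_le (sup_le le_sup_left ?_) le_sup_right
        rwa [Submodule.span_singleton_le_iff_mem]
      have h4 := finrank_sup_colSpan_le X W B
      rw [h3, finrank_top, Module.finrank_fin_fun] at h4
      omega
    · obtain ⟨i, hi, hlt, hni⟩ := h.inactive b hb hbI
      refine ⟨i, Finset.mem_insert_of_mem hi, hlt, ?_⟩
      rw [Finset.erase_insert_of_ne (by rintro rfl; exact hxB hb), colSpan_insert, ← sup_assoc]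
      exact hni

/-- Every column outside `W` that precedes all of `S` can be exchanged into an internal basis. -/
theorem IsMinorBasis.exists_exchange (h : IsMinorBasis X I W (insert x S) B)
    (hmin : ∀ y ∈ S, x < y) (hxW : X x ∉ W) (hxB : x ∉ B) :
    ∃ b ∈ B, IsMinorBasis X I (W ⊔ Submodule.span ℝ {X x}) S (B.erase b) := by
  classical
  have hd := h.delete hmin hxB
  -- The part of `B` in the fundamental circuit of `x` modulo `W`. If it were empty, the elements of
  -- `B` could be dropped one by one while `X x` stays in the span, leaving `X x ∈ W`.
  let T := B.filter fun b => X x ∉ W ⊔ colSpan X (B.erase b)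
  have hT : T.Nonempty := by
    by_contra hT
    rw [Finset.not_nonempty_iff_eq_empty, Finset.filter_eq_empty_iff] at hT
    simp only [not_not] at hT
    apply hxW
    have key : ∀ R ⊆ B, X x ∈ W ⊔ colSpan X (B \ R) := by
      intro R
      induction R using Finset.induction_on with
      | empty =>
        intro _
        rw [Finset.sdiff_empty, h.sup_eq]
        trivial
      | insert a R haR ih =>
        intro hR
        have haB := hR (Finset.mem_insert_self a R)
        have h1 := ih ((Finset.subset_insert a R).trans hR)
        by_contra h2
        have h3 : insert a (B \ insert a R) = B \ R := by
          rw [Finset.insert_eq, Finset.sdiff_insert, ← Finset.insert_eq, Finset.insert_erase]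
          exact Finset.mem_sdiff.2 ⟨haB, haR⟩
        rw [← h3, colSpan_insert, sup_comm (Submodule.span ℝ {X a}), ← sup_assoc] at h1
        have h4 := mem_sup_span_exchange h1 h2
        refine notMem_sup_colSpan_erase h.card_add h.sup_eq haB
          ((?_ : _ ≤ W ⊔ colSpan X (B.erase a)) h4)
        refine sup_le (sup_le_sup_left (colSpan_mono X ?_) W) ?_
        · intro c hc
          rw [Finset.mem_sdiff, Finset.mem_insert, not_or] at hc
          exact Finset.mem_erase.2 ⟨hc.2.1, hc.1⟩
        · rw [Submodule.span_singleton_le_iff_mem]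
          exact hT haB
    have := key B le_rfl
    rwa [Finset.sdiff_self, colSpan, Finset.coe_empty, Set.image_empty, Submodule.span_empty,
      sup_bot_eq] at this
  -- Exchanging the last element of the circuit lets `b` itself witness the inactivity of the other
  -- circuit elements.
  set b := T.max' hT with hb
  have hbT : b ∈ T := T.max'_mem hT
  obtain ⟨hbB, hxb⟩ := Finset.mem_filter.1 hbT
  have htop := sup_span_singleton_eq_top (finrank_sup_colSpan_erase h.card_add h.sup_eq hbB) hxb
  refine ⟨b, hbB, (Finset.erase_subset _ _).trans hd.subset, ?_, ?_, ?_⟩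
  · rw [finrank_sup_span_singleton hxW, Finset.card_erase_of_mem hbB]
    have := Finset.card_pos.2 ⟨b, hbB⟩
    have := h.card_add
    omega
  · rw [sup_right_comm, htop]
  · intro b' hb' hbI
    have hb'B := Finset.mem_of_mem_erase hb'
    have hne := Finset.ne_of_mem_erase hb'
    by_cases hb'T : b' ∈ T
    · have hlt : b' < b := lt_of_le_of_ne (T.le_max' b' hb'T) hne
      refine ⟨b, hd.subset hbB, hlt, fun hmem => ?_⟩
      have hxb' := (Finset.mem_filter.1 hb'T).2
      rw [sup_right_comm] at hmem
      have hnb : X b ∉ W ⊔ colSpan X ((B.erase b).erase b') := fun hm =>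
        notMem_sup_colSpan_erase h.card_add h.sup_eq hbB
          (sup_le_sup_left (colSpan_mono X (Finset.erase_subset _ _)) W hm)
      have h1 := mem_sup_span_exchange hmem hnb
      rw [sup_assoc, sup_comm (colSpan X _), ← colSpan_insert, Finset.erase_right_comm,
        Finset.insert_erase (Finset.mem_erase.2 ⟨hne.symm, hbB⟩)] at h1
      exact hxb' h1
    -- Off the circuit, adjoining `x` does not enlarge `W + span (B \ b')`, so the old witness
    -- survives.
    · have hxb' : X x ∈ W ⊔ colSpan X (B.erase b') := by
        by_contra hxb'
        exact hb'T (Finset.mem_filter.2 ⟨hb'B, hxb'⟩)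
      obtain ⟨i, hi, hlt, hni⟩ := hd.inactive b' hb'B hbI
      refine ⟨i, hi, hlt, fun hmem => hni ((?_ : _ ≤ W ⊔ colSpan X (B.erase b')) hmem)⟩
      refine sup_le (sup_le le_sup_left ?_) (le_sup_of_le_right (colSpan_mono X ?_))
      · rwa [Submodule.span_singleton_le_iff_mem]
      · rw [Finset.erase_right_comm]
        exact Finset.erase_subset _ _

/-- Bases of the deletion avoid `x`; those of the contraction, with `x` adjoined, contain it. -/
theorem card_minorBases_add_le (hmin : ∀ y ∈ S, x < y) (hxW : X x ∉ W)
    (hx : x ∈ I → X x ∈ W ⊔ colSpan X S) :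
    (minorBases X I W S).card + (minorBases X I (W ⊔ Submodule.span ℝ {X x}) S).card ≤
      (minorBases X I W (insert x S)).card := by
  classical
  have hnot : ∀ {W' B}, B ∈ minorBases X I W' S → x ∉ B := fun hB hxB =>
    lt_irrefl _ (hmin x ((mem_minorBases.1 hB).subset hxB))
  have hinj : Set.InjOn (insert x)
      (minorBases X I (W ⊔ Submodule.span ℝ {X x}) S : Set (Finset ι)) := by
    intro B hB B' hB' heq
    rw [← Finset.erase_insert (hnot hB), ← Finset.erase_insert (hnot hB'), heq]
  rw [← Finset.card_image_of_injOn hinj, ← Finset.card_union_of_disjoint]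
  · refine Finset.card_le_card (Finset.union_subset ?_ ?_)
    · intro B hB
      exact mem_minorBases.2 ((mem_minorBases.1 hB).mono (Finset.subset_insert x S))
    · intro B hB
      obtain ⟨B', hB', rfl⟩ := Finset.mem_image.1 hB
      exact mem_minorBases.2 ((mem_minorBases.1 hB').uncontract hmin hxW hx)
  · rw [Finset.disjoint_left]
    intro B hB hB'
    obtain ⟨B', _, rfl⟩ := Finset.mem_image.1 hB'
    exact hnot hB (Finset.mem_insert_self x B')

end Minors

/-! ### Ideals of minors and the upper bound for their codimension. -/

section MinorIdeals

variable {n : ℕ} {ι : Type*} [LinearOrder ι]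

/-- `Y` meets every `I`-internal basis of the minor. -/
def IsMinorLong (X : ι → Fin n → ℝ) (I : Finset ι) (W : Submodule ℝ (Fin n → ℝ))
    (S Y : Finset ι) : Prop :=
  ∀ B, IsMinorBasis X I W S B → (Y ∩ B).Nonempty

/-- The ideal of the polynomials that vanish on `W^⊥` and of the products over long sets. -/
def minorIdeal (X : ι → Fin n → ℝ) (I : Finset ι) (W : Submodule ℝ (Fin n → ℝ)) (S : Finset ι) :
    Ideal (Poly n) :=
  vanishing W ⊔ Ideal.span {q | ∃ Y : Finset ι, IsMinorLong X I W S Y ∧ q = prodForm X Y}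

variable {X : ι → Fin n → ℝ} {I : Finset ι} {W : Submodule ℝ (Fin n → ℝ)} {S : Finset ι} {x : ι}

theorem vanishing_le_minorIdeal : vanishing W ≤ minorIdeal X I W S := le_sup_left

theorem prodForm_mem_minorIdeal {Y : Finset ι} (hY : IsMinorLong X I W S Y) :
    prodForm X Y ∈ minorIdeal X I W S :=
  Ideal.mem_sup_right (Ideal.subset_span ⟨Y, hY, rfl⟩)

theorem minorIdeal_le {J : Ideal (Poly n)} (hZ : vanishing W ≤ J)
    (hY : ∀ Y, IsMinorLong X I W S Y → prodForm X Y ∈ J) : minorIdeal X I W S ≤ J := by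
  refine sup_le hZ (Ideal.span_le.2 ?_)
  rintro _ ⟨Y, h, rfl⟩
  exact hY Y h

/-- Without internal bases the empty set is long, and its product is `1`. -/
theorem minorIdeal_eq_top (h : ∀ B, ¬ IsMinorBasis X I W S B) : minorIdeal X I W S = ⊤ := by
  rw [Ideal.eq_top_iff_one]
  have := prodForm_mem_minorIdeal (X := X) (I := I) (W := W) (S := S) (Y := ∅)
    fun B hB => absurd hB (h B)
  simpa [prodForm] using this

theorem minorIdeal_anti {S' : Finset ι}
    (h : ∀ B, IsMinorBasis X I W S' B → IsMinorBasis X I W S B) :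
    minorIdeal X I W S ≤ minorIdeal X I W S' :=
  minorIdeal_le vanishing_le_minorIdeal fun _ hY => prodForm_mem_minorIdeal fun B hB => hY B (h B hB)

/-- If `Y` is long for the deletion, `Y ∪ {x}` is long for the minor: a basis without `x` is a basis
of the deletion. -/
theorem linForm_mul_mem_minorIdeal (hmin : ∀ y ∈ S, x < y) {q : Poly n}
    (hq : q ∈ minorIdeal X I W S) : linForm (X x) * q ∈ minorIdeal X I W (insert x S) := by
  have hle : minorIdeal X I W S ≤
      Submodule.comap (LinearMap.mul (Poly n) (Poly n) (linForm (X x)))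
        (minorIdeal X I W (insert x S)) := by
    refine minorIdeal_le (fun z hz => ?_) fun Y hY => ?_
    · exact Ideal.mul_mem_left _ _ (vanishing_le_minorIdeal hz)
    · change linForm (X x) * prodForm X Y ∈ minorIdeal X I W (insert x S)
      by_cases hxY : x ∈ Y
      · refine Ideal.mul_mem_left _ _ (prodForm_mem_minorIdeal fun B hB => ?_)
        by_cases hxB : x ∈ B
        · exact ⟨x, Finset.mem_inter.2 ⟨hxY, hxB⟩⟩
        · exact hY B (hB.delete hmin hxB)
      · rw [prodForm, ← Finset.prod_insert (f := fun y => linForm (X y)) hxY]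
        refine prodForm_mem_minorIdeal fun B hB => ?_
        by_cases hxB : x ∈ B
        · exact ⟨x, Finset.mem_inter.2 ⟨Finset.mem_insert_self x Y, hxB⟩⟩
        · exact (hY B (hB.delete hmin hxB)).mono
            (Finset.inter_subset_inter_right (Finset.subset_insert x Y))
  exact hle hq

/-- A set without `x` that is long for the contraction is long for the minor. For bases containing
`x` this is contraction; for the others it is the exchange lemma. -/
theorem exists_sub_linForm_mul_mem_minorIdeal (hmin : ∀ y ∈ S, x < y) (hxW : X x ∉ W) {q : Poly n}
    (hq : q ∈ minorIdeal X I (W ⊔ Submodule.span ℝ {X x}) S) :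
    ∃ r, q - linForm (X x) * r ∈ minorIdeal X I W (insert x S) := by
  have hle : minorIdeal X I (W ⊔ Submodule.span ℝ {X x}) S ≤
      minorIdeal X I W (insert x S) ⊔ Ideal.span {linForm (X x)} := by
    refine minorIdeal_le (fun z hz => ?_) fun Y hY => ?_
    · obtain ⟨r, z', hz', rfl⟩ := exists_eq_linForm_mul_add hz
      rw [add_comm]
      exact Submodule.add_mem_sup (vanishing_le_minorIdeal hz')
        (Ideal.mul_mem_right _ _ (Ideal.mem_span_singleton_self _))
    · by_cases hxY : x ∈ Y
      · refine Ideal.mem_sup_right (Ideal.mem_span_singleton.2 ?_)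
        exact Finset.dvd_prod_of_mem (fun y => linForm (X y)) hxY
      · refine Ideal.mem_sup_left (prodForm_mem_minorIdeal fun B hB => ?_)
        by_cases hxB : x ∈ B
        · exact (hY _ (hB.contract hmin hxB)).mono
            (Finset.inter_subset_inter_left (Finset.erase_subset _ _))
        · obtain ⟨b, -, hb⟩ := hB.exists_exchange hmin hxW hxB
          exact (hY _ hb).mono (Finset.inter_subset_inter_left (Finset.erase_subset _ _))
  obtain ⟨y, hy, z, hz, rfl⟩ := Submodule.mem_sup.1 (hle hq)
  obtain ⟨r, rfl⟩ := Ideal.mem_span_singleton'.1 hz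
  exact ⟨r, by rwa [mul_comm, add_sub_cancel_right]⟩

/-- The quotient of `Π` by an ideal, as a complex vector space. -/
abbrev QuotientSpace (J : Ideal (Poly n)) : Type := Poly n ⧸ J.restrictScalars ℂ

theorem finrank_quotientSpace_mono {J J' : Ideal (Poly n)} [Module.Finite ℂ (QuotientSpace J)]
    (h : J ≤ J') : Module.Finite ℂ (QuotientSpace J') ∧
      Module.finrank ℂ (QuotientSpace J') ≤ Module.finrank ℂ (QuotientSpace J) := by
  have hs := Submodule.factor_surjective (show J.restrictScalars ℂ ≤ J'.restrictScalars ℂ from h)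
  exact ⟨Module.Finite.of_surjective _ hs, LinearMap.finrank_le_finrank_of_surjective hs⟩

/-- Induction on `S`, removing its first column `x`. If `X x ∈ W`, deletion suffices; if `x ∈ I` is
independent of the rest modulo `W`, there are no internal bases; otherwise the bounds for deletion
and contraction add. -/
theorem finrank_quotientSpace_minorIdeal_le (S : Finset ι) :
    ∀ W : Submodule ℝ (Fin n → ℝ), Module.Finite ℂ (QuotientSpace (minorIdeal X I W S)) ∧
      Module.finrank ℂ (QuotientSpace (minorIdeal X I W S)) ≤ (minorBases X I W S).card := by
  have htop : ∀ (W : Submodule ℝ (Fin n → ℝ)) (S : Finset ι), (∀ B, ¬ IsMinorBasis X I W S B) →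
      Module.Finite ℂ (QuotientSpace (minorIdeal X I W S)) ∧
      Module.finrank ℂ (QuotientSpace (minorIdeal X I W S)) ≤ (minorBases X I W S).card := by
    intro W S h
    have hs : (minorIdeal X I W S).restrictScalars ℂ ⊔
        Submodule.span ℂ ((∅ : Finset (Poly n)) : Set (Poly n)) = ⊤ := by
      rw [minorIdeal_eq_top h]
      simp
    obtain ⟨h1, h2⟩ := finite_quotient_of_sup_span_eq_top hs
    exact ⟨h1, h2.trans (by simp)⟩
  refine Finset.induction_on_min S ?_ ?_
  · intro W
    by_cases hW : W = ⊤
    -- Here `W^⊥` is the origin, so the quotient is spanned by `1`, matching the single basis `∅`.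
    · subst hW
      have hs : (minorIdeal X I ⊤ ∅).restrictScalars ℂ ⊔
          Submodule.span ℂ (({1} : Finset (Poly n)) : Set (Poly n)) = ⊤ := by
        rw [eq_top_iff]
        intro p _
        have : p = (p - C (evalReal 0 p)) + C (evalReal 0 p) := by ring
        rw [this]
        refine Submodule.add_mem_sup (vanishing_le_minorIdeal fun a ha => ?_) ?_
        · rw [perp_top, Submodule.mem_bot] at ha
          rw [ha, map_sub]
          simp [evalReal]
        · rw [Finset.coe_singleton, Submodule.mem_span_singleton]
          exact ⟨evalReal 0 p, by rw [smul_eq_C_mul, mul_one]⟩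
      obtain ⟨h1, h2⟩ := finite_quotient_of_sup_span_eq_top hs
      refine ⟨h1, h2.trans ?_⟩
      rw [Finset.card_singleton, Nat.one_le_iff_ne_zero, Finset.card_ne_zero]
      exact ⟨∅, mem_minorBases.2 ⟨le_rfl, by simp, by simp, by simp⟩⟩
    · refine htop W ∅ fun B hB => hW ?_
      have := hB.sup_eq
      rwa [Finset.subset_empty.1 hB.subset, colSpan, Finset.coe_empty, Set.image_empty,
        Submodule.span_empty, sup_bot_eq] at this
  · intro x S hmin ih W
    by_cases hxW : X x ∈ W
    · obtain ⟨h1, h2⟩ := ih W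
      obtain ⟨h3, h4⟩ := finrank_quotientSpace_mono
        (minorIdeal_anti (X := X) (I := I) (W := W) (S := S) (S' := insert x S)
          fun B hB => hB.of_insert_of_mem hxW)
      refine ⟨h3, (h4.trans h2).trans (Finset.card_le_card fun B hB => ?_)⟩
      exact mem_minorBases.2 ((mem_minorBases.1 hB).mono (Finset.subset_insert x S))
    by_cases hcol : x ∈ I → X x ∈ W ⊔ colSpan X S
    · obtain ⟨h1, h2⟩ := ih W
      obtain ⟨h3, h4⟩ := ih (W ⊔ Submodule.span ℝ {X x})
      obtain ⟨h5, h6⟩ := finrank_quotient_le_add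
        (M := (minorIdeal X I W (insert x S)).restrictScalars ℂ)
        (M₁ := (minorIdeal X I W S).restrictScalars ℂ)
        (M₂ := (minorIdeal X I (W ⊔ Submodule.span ℝ {X x}) S).restrictScalars ℂ)
        (LinearMap.mulLeft ℂ (linForm (X x)))
        (fun q hq => linForm_mul_mem_minorIdeal hmin hq)
        (fun q hq => exists_sub_linForm_mul_mem_minorIdeal hmin hxW hq)
      exact ⟨h5, h6.trans ((add_le_add h2 h4).trans (card_minorBases_add_le hmin hxW hcol))⟩
    · push Not at hcol
      exact htop W _ fun B => not_isMinorBasis_of_coloop hcol.1 hcol.2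

end MinorIdeals

/-! ### Kernels and annihilators of ideals. -/

section Kernels

variable {n : ℕ}

/-- The pairing embeds the kernel of an ideal into the annihilator of the ideal. -/
def kerToAnnihilator (J : Ideal (Poly n)) :
    idealKer J →ₗ[ℂ] (J.restrictScalars ℂ).dualAnnihilator :=
  ((pairing n).flip.domRestrict (idealKer J)).codRestrict _ fun q => by
    rw [Submodule.mem_dualAnnihilator]
    intro p hp
    exact mem_idealKer_iff.1 q.2 p hp

theorem kerToAnnihilator_injective (J : Ideal (Poly n)) :
    Function.Injective (kerToAnnihilator J) := by
  rw [← LinearMap.ker_eq_bot, LinearMap.ker_eq_bot']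
  intro q hq
  apply Subtype.ext
  refine eq_zero_of_pairing_eq_zero fun p => ?_
  exact congrArg (fun f => (f : Module.Dual ℂ (Poly n)) p) (congrArg Subtype.val hq)

theorem finite_dualAnnihilator (J : Ideal (Poly n)) [Module.Finite ℂ (QuotientSpace J)] :
    Module.Finite ℂ (J.restrictScalars ℂ).dualAnnihilator ∧
      Module.finrank ℂ (J.restrictScalars ℂ).dualAnnihilator =
        Module.finrank ℂ (QuotientSpace J) := by
  let e := (J.restrictScalars ℂ).dualQuotEquivDualAnnihilator
  exact ⟨Module.Finite.equiv e, by rw [← e.finrank_eq, Subspace.dual_finrank_eq]⟩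

theorem finrank_idealKer_le (J : Ideal (Poly n)) [Module.Finite ℂ (QuotientSpace J)] :
    Module.Finite ℂ (idealKer J) ∧
      Module.finrank ℂ (idealKer J) ≤ Module.finrank ℂ (QuotientSpace J) := by
  obtain ⟨h1, h2⟩ := finite_dualAnnihilator J
  refine ⟨Module.Finite.of_injective _ (kerToAnnihilator_injective J), ?_⟩
  rw [← h2]
  exact LinearMap.finrank_le_finrank_of_injective (kerToAnnihilator_injective J)

end Kernels

/-! ### Vertices of the arrangement and the exact codimension. -/

section Arrangements

variable {n : ℕ} {ι : Type*} {X : ι → Fin n → ℝ} {lam : ι → ℝ}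

theorem finrank_add_finrank_perp_ge (W : Submodule ℝ (Fin n → ℝ)) :
    n ≤ Module.finrank ℝ W + Module.finrank ℝ (perp W) := by
  have htop : W ⊔ perp W = ⊤ := by
    by_contra h
    obtain ⟨x, -, hx⟩ := SetLike.exists_of_lt (lt_top_iff_ne_top.2 h)
    obtain ⟨a, ha, hxa⟩ := exists_mem_perp hx
    rw [mem_perp_sup] at ha
    have : a = 0 := dotProduct_self_eq_zero.1 (ha.2 a ha.1)
    rw [this, dotProduct_zero] at hxa
    exact zero_ne_one hxa
  have h := Submodule.finrank_add_le_finrank_add_finrank W (perp W)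
  rw [htop, finrank_top, Module.finrank_fin_fun] at h
  exact h

theorem mem_iInter_hyperplane {S : Finset ι} {t : Fin n → ℝ} :
    t ∈ ⋂ i ∈ S, hyperplane X lam i ↔ ∀ i ∈ S, X i ⬝ᵥ t = lam i := by
  simp [hyperplane]

/-- Hyperplanes of a simple arrangement that have a common point have independent normals. -/
theorem IsSimple.card_le_finrank (h : IsSimple X lam) {S : Finset ι} {t : Fin n → ℝ}
    (ht : ∀ i ∈ S, X i ⬝ᵥ t = lam i) : S.card ≤ Module.finrank ℝ (colSpan X S) := by
  rw [← mem_iInter_hyperplane (X := X) (lam := lam)] at ht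
  rcases h S with h | h
  · rw [h] at ht
    exact absurd ht (Set.notMem_empty t)
  have hle : perp (colSpan X S) ≤ vectorSpan ℝ (⋂ i ∈ S, hyperplane X lam i) := by
    intro a ha
    have : t + a ∈ ⋂ i ∈ S, hyperplane X lam i := by
      rw [mem_iInter_hyperplane] at ht ⊢
      intro i hi
      rw [dotProduct_add, ht i hi, ha _ (mem_colSpan X hi), add_zero]
    have h2 := vsub_mem_vectorSpan ℝ this ht
    simpa using h2
  have h1 := Submodule.finrank_mono hle
  have h2 := finrank_add_finrank_perp_ge (colSpan X S)
  omega

theorem exists_vertex {B : Finset ι} (hc : B.card = n) (hs : colSpan X B = ⊤) (lam : ι → ℝ) :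
    ∃ t, ∀ i ∈ B, X i ⬝ᵥ t = lam i := by
  let f : (Fin n → ℝ) →ₗ[ℝ] (B → ℝ) := Matrix.mulVecLin (Matrix.of fun i : B => X i)
  have hf : ∀ t i, f t i = X i ⬝ᵥ t := fun t i => rfl
  have hinj : Function.Injective f := by
    rw [← LinearMap.ker_eq_bot, LinearMap.ker_eq_bot']
    intro t ht
    have : t ∈ perp (colSpan X B) := by
      rw [colSpan, mem_perp_span]
      rintro _ ⟨i, hi, rfl⟩
      have := congrFun ht ⟨i, hi⟩
      rwa [hf] at this
    rw [hs, perp_top] at this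
    exact this
  have hsurj : Function.Surjective f :=
    (LinearMap.injective_iff_surjective_of_finrank_eq_finrank (by simp [hc])).1 hinj
  obtain ⟨t, ht⟩ := hsurj fun i => lam i
  exact ⟨t, fun i hi => by rw [← hf t ⟨i, hi⟩, ht]⟩

variable [LinearOrder ι] {I : Finset ι}

theorem IsMinorBasis.union_basis {C S B : Finset ι}
    (hC : C.card = Module.finrank ℝ (colSpan X C)) (h : IsMinorBasis X I (colSpan X C) S B) :
    (B ∪ C).card = n ∧ Disjoint B C ∧ colSpan X (B ∪ C) = ⊤ := by
  have h1 : colSpan X (B ∪ C) = ⊤ := by rw [colSpan_union, sup_comm, h.sup_eq]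
  have h2 := finrank_colSpan_le X (B ∪ C)
  rw [h1, finrank_top, Module.finrank_fin_fun] at h2
  have h3 := h.card_add
  have h4 := Finset.card_union_le B C
  refine ⟨by omega, Finset.card_union_eq_card_add_card.1 (by omega), h1⟩

theorem minorIdeal_colSpan_eq (C S : Finset ι) :
    minorIdeal X I (colSpan X C) S = Ideal.span ((fun i => linForm (X i)) '' (C : Set ι) ∪
      {q | ∃ Y : Finset ι, IsMinorLong X I (colSpan X C) S Y ∧ q = prodForm X Y}) := by
  rw [minorIdeal, vanishing_span_image, Ideal.span_union]

/-- The least space of the vertices of a minor lies in the kernel of the ideal of the minor. -/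
theorem leastSpace_le_idealKer_minorIdeal {C S : Finset ι} {V : Finset (Fin n → ℝ)}
    (hV : ∀ v ∈ V, ∃ B, IsMinorBasis X I (colSpan X C) S B ∧ ∀ i ∈ B ∪ C, X i ⬝ᵥ v = lam i) :
    leastSpace (V : Set (Fin n → ℝ)) ≤ idealKer (minorIdeal X I (colSpan X C) S) := by
  rw [minorIdeal_colSpan_eq]
  apply leastSpace_le_idealKer
  rintro _ (⟨i, hi, rfl⟩ | ⟨Y, hY, rfl⟩)
  · refine ⟨1, _, isLeadingForm_linForm_sub_C (X i) (lam i), fun v hv => ?_⟩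
    obtain ⟨B, -, hB⟩ := hV v hv
    rw [map_sub, evalReal_linForm, hB i (Finset.mem_union_right _ hi)]
    simp [evalReal]
  · refine ⟨Y.card, _, isLeadingForm_prod Y X fun y => (lam y : ℂ), fun v hv => ?_⟩
    obtain ⟨B, hB, hBv⟩ := hV v hv
    obtain ⟨y, hy⟩ := hY B hB
    rw [Finset.mem_inter] at hy
    rw [map_prod]
    refine Finset.prod_eq_zero hy.1 ?_
    rw [map_sub, evalReal_linForm, hBv y (Finset.mem_union_left _ hy.2)]
    simp [evalReal]

/-- The vertices of the internal bases of a minor are distinct. -/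
theorem exists_vertices (hsimple : IsSimple X lam) {C : Finset ι}
    (hC : C.card = Module.finrank ℝ (colSpan X C)) (S : Finset ι) :
    ∃ V : Finset (Fin n → ℝ), V.card = (minorBases X I (colSpan X C) S).card ∧
      ∀ v, v ∈ V ↔ ∃ B, IsMinorBasis X I (colSpan X C) S B ∧ ∀ i ∈ B ∪ C, X i ⬝ᵥ v = lam i := by
  classical
  have hex : ∀ B : Finset ι, ∃ t, IsMinorBasis X I (colSpan X C) S B →
      ∀ i ∈ B ∪ C, X i ⬝ᵥ t = lam i := by
    intro B
    by_cases hB : IsMinorBasis X I (colSpan X C) S B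
    · obtain ⟨h1, -, h2⟩ := hB.union_basis hC
      obtain ⟨t, ht⟩ := exists_vertex h1 h2 lam
      exact ⟨t, fun _ => ht⟩
    · exact ⟨0, fun h => absurd h hB⟩
  choose vert hvert using hex
  refine ⟨(minorBases X I (colSpan X C) S).image vert, Finset.card_image_of_injOn ?_, ?_⟩
  · intro B hB B' hB' heq
    rw [Finset.mem_coe, mem_minorBases] at hB hB'
    obtain ⟨h1, h2, -⟩ := hB.union_basis hC
    obtain ⟨h1', h2', -⟩ := hB'.union_basis hC
    -- Equal vertices put all these hyperplanes through one point. Simplicity then allows at most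
    -- `n` of them, which forces `B ∪ C = B' ∪ C`.
    have hpt : ∀ i ∈ (B ∪ C) ∪ (B' ∪ C), X i ⬝ᵥ vert B = lam i := by
      intro i hi
      rcases Finset.mem_union.1 hi with hi | hi
      · exact hvert B hB i hi
      · rw [heq]
        exact hvert B' hB' i hi
    have h3 := (hsimple.card_le_finrank hpt).trans (Submodule.finrank_le _)
    rw [Module.finrank_fin_fun] at h3
    have h4 : B ∪ C = (B ∪ C) ∪ (B' ∪ C) :=
      Finset.eq_of_subset_of_card_le Finset.subset_union_left (by omega)
    have h5 : B' ∪ C = (B ∪ C) ∪ (B' ∪ C) :=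
      Finset.eq_of_subset_of_card_le Finset.subset_union_right (by omega)
    have h6 : B ∪ C = B' ∪ C := h4.trans h5.symm
    rw [← Finset.union_sdiff_cancel_right h2, h6, Finset.union_sdiff_cancel_right h2']
  · intro v
    rw [Finset.mem_image]
    constructor
    · rintro ⟨B, hB, rfl⟩
      exact ⟨B, mem_minorBases.1 hB, hvert B (mem_minorBases.1 hB)⟩
    · rintro ⟨B, hB, hv⟩
      refine ⟨B, mem_minorBases.2 hB, ?_⟩
      obtain ⟨-, -, h2⟩ := hB.union_basis hC
      rw [← sub_eq_zero, ← Submodule.mem_bot ℝ, ← perp_top, ← h2, colSpan, mem_perp_span]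
      rintro _ ⟨i, hi, rfl⟩
      rw [dotProduct_sub, hv i hi, hvert B hB i hi, sub_self]

/-- The chain `#V ≤ dim (least space) ≤ dim (kernel) ≤ codimension` closes the upper bound. Its
sharpness on minors is what later identifies a colon ideal. -/
theorem finrank_quotientSpace_minorIdeal (hsimple : IsSimple X lam) {C : Finset ι}
    (hC : C.card = Module.finrank ℝ (colSpan X C)) (S : Finset ι) :
    Module.finrank ℂ (QuotientSpace (minorIdeal X I (colSpan X C) S)) =
      (minorBases X I (colSpan X C) S).card := by
  obtain ⟨hfin, hle⟩ := finrank_quotientSpace_minorIdeal_le (X := X) (I := I) S (colSpan X C)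
  refine le_antisymm hle ?_
  obtain ⟨V, hcard, hV⟩ := exists_vertices (I := I) hsimple hC S
  obtain ⟨hfin', hle'⟩ := finrank_idealKer_le (minorIdeal X I (colSpan X C) S)
  have hsub := leastSpace_le_idealKer_minorIdeal (X := X) (I := I) (lam := lam) (C := C) (S := S)
    (V := V) fun v hv => (hV v).1 hv
  have : Module.Finite ℂ (leastSpace (V : Set (Fin n → ℝ))) :=
    Module.Finite.of_injective _ (Submodule.inclusion_injective hsub)
  rw [← hcard]
  exact (card_le_finrank_leastSpace V).trans ((Submodule.finrank_mono hsub).trans hle')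

end Arrangements

/-! ### Degree conditions along facet normals. -/

section Facets

variable {n : ℕ} {ι : Type*}

/-- `η` is a normal of a hyperplane that is spanned by columns. -/
def IsFacetNormal (X : ι → Fin n → ℝ) (η : Fin n → ℝ) : Prop :=
  η ≠ 0 ∧ ∀ v, v ⬝ᵥ η = 0 → v ∈ Submodule.span ℝ (X '' {i | X i ⬝ᵥ η = 0})

/-- The number of columns in `S` that are not orthogonal to `η`. -/
def crossCount (X : ι → Fin n → ℝ) (S : Finset ι) (η : Fin n → ℝ) : ℕ :=
  (S.filter fun i => X i ⬝ᵥ η ≠ 0).card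

open Classical in
/-- The number of columns in `S` that are not orthogonal to `η`, diminished by one if one of them
lies in `I`. -/
def facetExp (X : ι → Fin n → ℝ) (I S : Finset ι) (η : Fin n → ℝ) : ℕ :=
  crossCount X S η - if ∃ b ∈ S, b ∈ I ∧ X b ⬝ᵥ η ≠ 0 then 1 else 0

/-- The polynomials that have degree less than `facetExp X I S η` along each facet normal `η`, on
the real points of `W^⊥`. -/
def facetKernel (X : ι → Fin n → ℝ) (I : Finset ι) (W : Submodule ℝ (Fin n → ℝ))
    (S : Finset ι) : Submodule ℂ (Poly n) where
  carrier := {p | ∀ η, IsFacetNormal X η → η ∈ perp W →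
    (dirEnd η ^ facetExp X I S η) p ∈ vanishing W}
  add_mem' hp hq η h h' := by
    rw [map_add]
    exact add_mem (hp η h h') (hq η h h')
  zero_mem' η _ _ := by
    rw [map_zero]
    exact zero_mem _
  smul_mem' c p hp η h h' := by
    rw [map_smul, smul_eq_C_mul]
    exact Ideal.mul_mem_left _ _ (hp η h h')

variable {X : ι → Fin n → ℝ} {I : Finset ι} {W : Submodule ℝ (Fin n → ℝ)} {S : Finset ι}
  {x : ι}

theorem mem_facetKernel {p : Poly n} : p ∈ facetKernel X I W S ↔
    ∀ η, IsFacetNormal X η → η ∈ perp W → (dirEnd η ^ facetExp X I S η) p ∈ vanishing W := Iff.rfl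

/-- A maximal column set containing `T` whose span misses `X j` spans a hyperplane, since any
further column would bring `X j` into the span. -/
theorem exists_isFacetNormal [Fintype ι] (hspan : colSpan X Finset.univ = ⊤) {T : Finset ι}
    {j : ι} (hj : X j ∉ colSpan X T) :
    ∃ η, IsFacetNormal X η ∧ η ∈ perp (colSpan X T) ∧ X j ⬝ᵥ η ≠ 0 := by
  classical
  obtain ⟨T', hTT', hT'⟩ : ∃ T', T ≤ T' ∧ Maximal (fun R : Finset ι => X j ∉ colSpan X R) T' :=
    (Set.toFinite {R : Finset ι | X j ∉ colSpan X R}).exists_le_maximal hj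
  obtain ⟨η, hη, hjη⟩ := exists_mem_perp hT'.prop
  have hjη0 : X j ⬝ᵥ η ≠ 0 := by
    rw [hjη]
    exact one_ne_zero
  refine ⟨η, ⟨?_, ?_⟩, perp_anti (colSpan_mono X hTT') hη, hjη0⟩
  · rintro rfl
    simp at hjη
  have htop : colSpan X T' ⊔ Submodule.span ℝ {X j} = ⊤ := by
    rw [eq_top_iff, ← hspan, colSpan, Submodule.span_le]
    rintro _ ⟨i, -, rfl⟩
    by_cases hi : i ∈ T'
    · exact Submodule.mem_sup_left (mem_colSpan X hi)
    · have h1 : X j ∈ colSpan X (insert i T') := by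
        by_contra h1
        exact hi (hT'.le_of_ge h1 (Finset.subset_insert i T') (Finset.mem_insert_self i T'))
      rw [colSpan_insert, sup_comm] at h1
      exact mem_sup_span_exchange h1 hT'.prop
  intro v hv
  obtain ⟨h, hh, z, hz, rfl⟩ := Submodule.mem_sup.1 (htop ▸ Submodule.mem_top : v ∈ _)
  obtain ⟨c, rfl⟩ := Submodule.mem_span_singleton.1 hz
  rw [add_dotProduct, hη h hh, zero_add, smul_dotProduct, hjη, smul_eq_mul, mul_one] at hv
  rw [hv, zero_smul, add_zero]
  refine Submodule.span_mono (Set.image_mono ?_) hh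
  intro i hi
  exact hη _ (mem_colSpan X hi)

theorem crossCount_eq_zero {η : Fin n → ℝ} (hη : η ∈ perp (colSpan X S)) :
    crossCount X S η = 0 := by
  rw [crossCount, Finset.card_eq_zero, Finset.filter_eq_empty_iff]
  intro i hi
  rw [not_not]
  exact hη _ (mem_colSpan X hi)

variable [LinearOrder ι]

theorem facetExp_insert_of_eq_zero {η : Fin n → ℝ} (hx : X x ⬝ᵥ η = 0) :
    facetExp X I (insert x S) η = facetExp X I S η := by
  classical
  have h1 : crossCount X (insert x S) η = crossCount X S η := by
    rw [crossCount, Finset.filter_insert, if_neg (by simpa using hx), crossCount]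
  have h2 : (∃ b ∈ insert x S, b ∈ I ∧ X b ⬝ᵥ η ≠ 0) ↔ ∃ b ∈ S, b ∈ I ∧ X b ⬝ᵥ η ≠ 0 := by
    simp [hx]
  rw [facetExp, facetExp, h1]
  by_cases h : ∃ b ∈ S, b ∈ I ∧ X b ⬝ᵥ η ≠ 0
  · rw [if_pos h, if_pos (h2.2 h)]
  · rw [if_neg h, if_neg (h2.not.2 h)]

theorem crossCount_insert_of_ne_zero {η : Fin n → ℝ} (hxS : x ∉ S) (hx : X x ⬝ᵥ η ≠ 0) :
    crossCount X (insert x S) η = crossCount X S η + 1 := by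
  rw [crossCount, Finset.filter_insert, if_pos hx, Finset.card_insert_of_notMem, crossCount]
  simp [hxS]

theorem facetExp_insert_sub_one_le {η : Fin n → ℝ} (hxS : x ∉ S) (hx : X x ⬝ᵥ η ≠ 0) :
    facetExp X I (insert x S) η - 1 ≤ facetExp X I S η := by
  rw [facetExp, facetExp, crossCount_insert_of_ne_zero hxS hx]
  by_cases h : ∃ b ∈ S, b ∈ I ∧ X b ⬝ᵥ η ≠ 0
  · have h' : ∃ b ∈ insert x S, b ∈ I ∧ X b ⬝ᵥ η ≠ 0 := by
      obtain ⟨b, hb, h⟩ := h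
      exact ⟨b, Finset.mem_insert_of_mem hb, h⟩
    rw [if_pos h, if_pos h']
    omega
  · rw [if_neg h]
    omega

/-- The facet conditions and the ideal of a minor are transversal. -/
theorem mem_vanishing_of_mem_facetKernel [Fintype ι] {lam : ι → ℝ}
    (hspan : colSpan X Finset.univ = ⊤) (hsimple : IsSimple X lam) (S : Finset ι) :
    ∀ C : Finset ι, C.card = Module.finrank ℝ (colSpan X C) → ∀ p : Poly n,
      p ∈ minorIdeal X I (colSpan X C) S → p ∈ facetKernel X I (colSpan X C) S →
        p ∈ vanishing (colSpan X C) := by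
  classical
  refine Finset.induction_on_min S ?_ ?_
  · intro C hC p hpJ hpK
    by_cases hW : colSpan X C = ⊤
    · have hle : minorIdeal X I (colSpan X C) ∅ ≤ vanishing (colSpan X C) := by
        refine minorIdeal_le le_rfl fun Y hY => ?_
        have := hY ∅ ⟨le_rfl, by rw [hW]; simp, by simp [hW], by simp⟩
        simp at this
      exact hle hpJ
    · obtain ⟨j, hj⟩ : ∃ j, X j ∉ colSpan X C := by
        by_contra! hall
        apply hW
        rw [eq_top_iff, ← hspan, colSpan, Submodule.span_le]
        rintro _ ⟨i, -, rfl⟩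
        exact hall i
      -- No column remains, so the exponent at `η` is zero and the condition says that `p` itself
      -- vanishes on `W^⊥`.
      obtain ⟨η, hη, hηC, -⟩ := exists_isFacetNormal hspan hj
      have := hpK η hη hηC
      rwa [facetExp, crossCount_eq_zero (by rw [colSpan, mem_perp_span]; simp), Nat.zero_sub,
        pow_zero] at this
  · intro x S hmin ih C hC p hpJ hpK
    have hxS : x ∉ S := fun h => lt_irrefl _ (hmin x h)
    by_cases hxW : X x ∈ colSpan X C
    · refine ih C hC p (minorIdeal_anti (fun B hB => hB.mono (Finset.subset_insert x S)) hpJ) ?_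
      intro η hη hηC
      rw [← facetExp_insert_of_eq_zero (x := x) (hηC _ hxW)]
      exact hpK η hη hηC
    by_cases hcol : x ∈ I → X x ∈ colSpan X C ⊔ colSpan X S
    · obtain ⟨hf1, hl1⟩ := finrank_quotientSpace_minorIdeal_le (X := X) (I := I) S (colSpan X C)
      obtain ⟨hf2, hl2⟩ := finrank_quotientSpace_minorIdeal_le (X := X) (I := I) S
        (colSpan X C ⊔ Submodule.span ℝ {X x})
      have heq := finrank_quotientSpace_minorIdeal (I := I) hsimple hC (insert x S)
      have hadd := card_minorBases_add_le (I := I) hmin hxW hcol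
      -- The deletion-contraction bound is attained, so the ideal of the deletion is the full colon
      -- ideal by `p_x`.
      have hcolon : ∀ q, linForm (X x) * q ∈ minorIdeal X I (colSpan X C) (insert x S) →
          q ∈ minorIdeal X I (colSpan X C) S := by
        intro q hq
        exact mem_of_finrank_quotient_ge
          (M := (minorIdeal X I (colSpan X C) (insert x S)).restrictScalars ℂ)
          (M₁ := (minorIdeal X I (colSpan X C) S).restrictScalars ℂ)
          (M₂ := (minorIdeal X I (colSpan X C ⊔ Submodule.span ℝ {X x}) S).restrictScalars ℂ)
          (LinearMap.mulLeft ℂ (linForm (X x)))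
          (fun q hq => linForm_mul_mem_minorIdeal hmin hq)
          (fun q hq => exists_sub_linForm_mul_mem_minorIdeal hmin hxW hq)
          ((add_le_add hl1 hl2).trans (hadd.trans heq.ge)) hq
      have hins : colSpan X (insert x C) = colSpan X C ⊔ Submodule.span ℝ {X x} := by
        rw [colSpan_insert, sup_comm]
      have hxC : x ∉ C := fun h => hxW (mem_colSpan X h)
      -- Restricting to `x^⊥` preserves both memberships, so by induction `p` vanishes there and is
      -- `p_x q` modulo polynomials vanishing on `W^⊥`.
      have hpJ' : p ∈ minorIdeal X I (colSpan X (insert x C)) S := by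
        refine minorIdeal_le (J := minorIdeal X I (colSpan X (insert x C)) S) ?_ ?_ hpJ
        · exact (vanishing_mono (colSpan_mono X (Finset.subset_insert x C))).trans
            vanishing_le_minorIdeal
        · intro Y hY
          by_cases hxY : x ∈ Y
          · refine vanishing_le_minorIdeal ?_
            refine Ideal.mem_of_dvd _ (Finset.dvd_prod_of_mem (fun y => linForm (X y)) hxY) ?_
            exact linForm_mem_vanishing (mem_colSpan X (Finset.mem_insert_self x C))
          · refine prodForm_mem_minorIdeal fun B hB => ?_
            rw [hins] at hB
            obtain ⟨y, hy⟩ := hY _ (hB.uncontract hmin hxW hcol)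
            rw [Finset.mem_inter, Finset.mem_insert] at hy
            refine ⟨y, Finset.mem_inter.2 ⟨hy.1, hy.2.resolve_left ?_⟩⟩
            rintro rfl
            exact hxY hy.1
      have hpK' : p ∈ facetKernel X I (colSpan X (insert x C)) S := by
        intro η hη hηC
        rw [← facetExp_insert_of_eq_zero (x := x)
          (hηC _ (mem_colSpan X (Finset.mem_insert_self x C)))]
        exact vanishing_mono (colSpan_mono X (Finset.subset_insert x C))
          (hpK η hη (perp_anti (colSpan_mono X (Finset.subset_insert x C)) hηC))
      have hpZ := ih (insert x C) (by
        rw [Finset.card_insert_of_notMem hxC, hins, finrank_sup_span_singleton hxW, hC]) p hpJ' hpK'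
      rw [hins] at hpZ
      obtain ⟨q, z, hz, rfl⟩ := exists_eq_linForm_mul_add hpZ
      refine add_mem (Ideal.mul_mem_left _ _ (ih C hC q ?_ ?_)) hz
      · exact hcolon q ((Ideal.add_mem_iff_left _ (vanishing_le_minorIdeal hz)).1 hpJ)
      · intro η hη hηC
        have h1 := hpK η hη hηC
        rw [map_add, Ideal.add_mem_iff_left _ (dirEnd_pow_mem_vanishing hηC _ hz)] at h1
        by_cases hxη : X x ⬝ᵥ η = 0
        · rw [facetExp_insert_of_eq_zero hxη, dirEnd_pow_linForm_mul_of_dotProduct_eq_zero hxη]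
            at h1
          exact (mem_or_mem_of_mul_mem_vanishing h1).resolve_left (linForm_notMem_vanishing hxW)
        -- Dividing by `p_x` lowers the degree along `η` by one; deleting `x` lowers the exponent by
        -- at most one.
        · exact dirEnd_pow_mem_vanishing_of_le hηC (facetExp_insert_sub_one_le hxS hxη)
            (dirEnd_pow_sub_one_mem_vanishing hηC hxη h1)
    · push Not at hcol
      obtain ⟨hxI, hxCS⟩ := hcol
      rw [← colSpan_union] at hxCS
      -- Only `x` crosses this hyperplane, and `x ∈ I` reduces the exponent from one to zero.
      obtain ⟨η, hη, hηCS, hxη⟩ := exists_isFacetNormal hspan hxCS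
      rw [colSpan_union, mem_perp_sup] at hηCS
      have h1 := hpK η hη hηCS.1
      rwa [facetExp, if_pos ⟨x, Finset.mem_insert_self x S, hxI, hxη⟩,
        crossCount_insert_of_ne_zero hxS hxη, crossCount_eq_zero hηCS.2, zero_add, Nat.sub_self,
        pow_zero] at h1

/-- The dimension of the space of the restrictions to `W^⊥` that satisfy the facet conditions. -/
theorem finrank_map_facetKernel_le [Fintype ι] {lam : ι → ℝ}
    (hspan : colSpan X Finset.univ = ⊤) (hsimple : IsSimple X lam) (S : Finset ι) {C : Finset ι}
    (hC : C.card = Module.finrank ℝ (colSpan X C)) :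
    Module.Finite ℂ ((facetKernel X I (colSpan X C) S).map
        ((vanishing (colSpan X C)).restrictScalars ℂ).mkQ) ∧
      Module.finrank ℂ ((facetKernel X I (colSpan X C) S).map
        ((vanishing (colSpan X C)).restrictScalars ℂ).mkQ) ≤
          (minorBases X I (colSpan X C) S).card := by
  obtain ⟨hfin, hle⟩ := finrank_quotientSpace_minorIdeal_le (X := X) (I := I) S (colSpan X C)
  have hZJ : (vanishing (colSpan X C)).restrictScalars ℂ ≤
      (minorIdeal X I (colSpan X C) S).restrictScalars ℂ := fun p hp => vanishing_le_minorIdeal hp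
  let g := (Submodule.factor hZJ).domRestrict ((facetKernel X I (colSpan X C) S).map
    ((vanishing (colSpan X C)).restrictScalars ℂ).mkQ)
  have hg : Function.Injective g := by
    rw [← LinearMap.ker_eq_bot, LinearMap.ker_eq_bot']
    rintro ⟨_, p, hp, rfl⟩ h0
    have h1 : p ∈ minorIdeal X I (colSpan X C) S := by
      simpa [g] using h0
    have := mem_vanishing_of_mem_facetKernel hspan hsimple S C hC p h1 hp
    apply Subtype.ext
    simpa using this
  exact ⟨Module.Finite.of_injective g hg,
    (LinearMap.finrank_le_finrank_of_injective hg).trans hle⟩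

end Facets

/-! ### A dimension bound for subspaces cut out by finitely many maps. -/

section LinearAlgebra

variable {K E F J : Type*} [Field K] [AddCommGroup E] [Module K E] [AddCommGroup F] [Module K F]
  [Fintype J]

theorem finrank_le_sum_finrank_add {M M' : Submodule K E} [Module.Finite K M]
    [Module.Finite K M'] (N : J → Submodule K F) [∀ j, Module.Finite K (N j)] (f : J → E →ₗ[K] F)
    (hf : ∀ j, ∀ p ∈ M, f j p ∈ N j) (hM' : ∀ p ∈ M, (∀ j, f j p = 0) → p ∈ M') :
    Module.finrank K M ≤ ∑ j, Module.finrank K (N j) + Module.finrank K M' := by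
  let Φ : M →ₗ[K] ∀ j, N j := LinearMap.pi fun j =>
    ((f j).domRestrict M).codRestrict (N j) fun p => hf j p p.2
  have hker : ∀ p : Φ.ker, (p : E) ∈ M' := fun p =>
    hM' _ p.1.2 fun j => congrArg Subtype.val (congrFun p.2 j)
  let g : Φ.ker →ₗ[K] M' := (M.subtype ∘ₗ Φ.ker.subtype).codRestrict M' hker
  have hg : Function.Injective g := fun p q hpq => by
    have : (g p : E) = g q := by rw [hpq]
    exact Subtype.ext (Subtype.ext this)
  have h1 := LinearMap.finrank_le_finrank_of_injective hg
  have h2 := Submodule.finrank_le Φ.range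
  rw [Module.finrank_pi_fintype] at h2
  have h3 := Φ.finrank_range_add_finrank_ker
  omega

end LinearAlgebra

/-! ### Central and semi-internal spaces as solutions of the facet conditions. -/

section CentralSpaces

variable {n : ℕ} {ι : Type*} {X : ι → Fin n → ℝ}

theorem crossCount_pos {S : Finset ι} {i : ι} {η : Fin n → ℝ} (hi : i ∈ S) (h : X i ⬝ᵥ η ≠ 0) :
    0 < crossCount X S η := Finset.card_pos.2 ⟨i, Finset.mem_filter.2 ⟨hi, h⟩⟩

theorem colSpan_eq_top_of_rk {S : Finset ι} (h : rk X S = n) : colSpan X S = ⊤ :=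
  eq_top_of_le_finrank h.ge

theorem rk_eq_of_colSpan_eq_top {S : Finset ι} (h : colSpan X S = ⊤) : rk X S = n := by
  change Module.finrank ℝ (colSpan X S) = n
  rw [h]
  simp

theorem exists_dotProduct_ne_zero {S : Finset ι} (h : colSpan X S = ⊤) {η : Fin n → ℝ}
    (hη : η ≠ 0) : ∃ i ∈ S, X i ⬝ᵥ η ≠ 0 := by
  by_contra! hall
  apply hη
  rw [← Submodule.mem_bot ℝ, ← perp_top, ← h, colSpan, mem_perp_span]
  rintro _ ⟨i, hi, rfl⟩
  exact hall i hi

theorem facetExp_empty (S : Finset ι) (η : Fin n → ℝ) :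
    facetExp X ∅ S η = crossCount X S η := by
  rw [facetExp, if_neg (by simp), Nat.sub_zero]

theorem mem_perp_bot (η : Fin n → ℝ) : η ∈ perp (⊥ : Submodule ℝ (Fin n → ℝ)) := by
  intro w hw
  rw [(Submodule.mem_bot ℝ).1 hw, zero_dotProduct]

theorem mem_facetKernel_bot {I S : Finset ι} {p : Poly n} : p ∈ facetKernel X I ⊥ S ↔
    ∀ η, IsFacetNormal X η → (dirEnd η ^ facetExp X I S η) p = 0 := by
  rw [mem_facetKernel]
  refine forall_congr' fun η => forall_congr' fun _ => ?_
  refine ⟨fun h => eq_zero_of_mem_vanishing_bot (h (mem_perp_bot η)), fun h _ => ?_⟩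
  rw [h]
  exact zero_mem _

theorem colSpan_empty : colSpan X ∅ = ⊥ := by
  rw [colSpan, Finset.coe_empty, Set.image_empty, Submodule.span_empty]

theorem card_empty_eq_finrank :
    (∅ : Finset ι).card = Module.finrank ℝ (colSpan X (∅ : Finset ι)) := by
  rw [colSpan_empty]
  simp

theorem card_singleton_eq_finrank {c : ι} (hc : X c ≠ 0) :
    ({c} : Finset ι).card = Module.finrank ℝ (colSpan X {c}) := by
  rw [colSpan, Finset.coe_singleton, Set.image_singleton, finrank_span_singleton hc,
    Finset.card_singleton]

variable [LinearOrder ι]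

theorem prodForm_insert {Y : Finset ι} {x : ι} (hx : x ∉ Y) :
    prodForm X (insert x Y) = linForm (X x) * prodForm X Y := Finset.prod_insert hx

theorem crossCount_insert_of_eq_zero {S : Finset ι} {x : ι} {η : Fin n → ℝ}
    (hx : X x ⬝ᵥ η = 0) : crossCount X (insert x S) η = crossCount X S η := by
  rw [crossCount, Finset.filter_insert, if_neg (by simpa using hx), crossCount]

theorem crossCount_erase_of_eq_zero {S : Finset ι} {x : ι} {η : Fin n → ℝ} (hx : x ∈ S)
    (h : X x ⬝ᵥ η = 0) : crossCount X (S.erase x) η = crossCount X S η := by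
  conv_rhs => rw [← Finset.insert_erase hx, crossCount_insert_of_eq_zero h]

theorem crossCount_erase_of_ne_zero {S : Finset ι} {x : ι} {η : Fin n → ℝ} (hx : x ∈ S)
    (h : X x ⬝ᵥ η ≠ 0) : crossCount X (S.erase x) η = crossCount X S η - 1 := by
  conv_rhs => rw [← Finset.insert_erase hx, crossCount_insert_of_ne_zero (by simp) h]
  rfl

theorem dirEnd_pow_prodForm_eq_zero (η : Fin n → ℝ) (Y : Finset ι) :
    ∀ k, crossCount X Y η < k → (dirEnd η ^ k) (prodForm X Y) = 0 := by
  induction Y using Finset.induction_on with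
  | empty =>
    intro k hk
    apply dirEnd_pow_eq_zero_of_le (k := 1) (by omega)
    rw [pow_one, prodForm, Finset.prod_empty, ← C_1, dirEnd_C]
  | insert x Y hx ih =>
    intro k hk
    rw [prodForm_insert hx]
    by_cases hη : X x ⬝ᵥ η = 0
    · rw [crossCount_insert_of_eq_zero hη] at hk
      rw [dirEnd_pow_linForm_mul_of_dotProduct_eq_zero hη, ih k hk, mul_zero]
    · rw [crossCount_insert_of_ne_zero hx hη] at hk
      obtain ⟨l, rfl⟩ : ∃ l, k = l + 1 := ⟨k - 1, by omega⟩
      rw [dirEnd_pow_succ_linForm_mul, ih l (by omega), ih (l + 1) (by omega), mul_zero, mul_zero,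
        add_zero]

/-- The top derivative of `p_Y` along `η` is a multiple of the product over `Y ∩ η^⊥`. -/
theorem exists_dirEnd_pow_prodForm (η : Fin n → ℝ) (Y : Finset ι) :
    ∃ a : ℂ, (dirEnd η ^ crossCount X Y η) (prodForm X Y) =
      C a * prodForm X (Y.filter fun i => X i ⬝ᵥ η = 0) := by
  induction Y using Finset.induction_on with
  | empty => exact ⟨1, by simp [crossCount, prodForm]⟩
  | insert x Y hx ih =>
    obtain ⟨a, ha⟩ := ih
    rw [prodForm_insert hx, Finset.filter_insert]
    by_cases hη : X x ⬝ᵥ η = 0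
    · refine ⟨a, ?_⟩
      rw [crossCount_insert_of_eq_zero hη, dirEnd_pow_linForm_mul_of_dotProduct_eq_zero hη, ha,
        if_pos hη, prodForm_insert (by simp [hx])]
      ring
    · refine ⟨(crossCount X Y η + 1) * ((X x ⬝ᵥ η : ℝ) : ℂ) * a, ?_⟩
      rw [crossCount_insert_of_ne_zero hx hη, dirEnd_pow_succ_linForm_mul, ha, if_neg hη,
        dirEnd_pow_prodForm_eq_zero η Y _ (Nat.lt_succ_self _), mul_zero, zero_add, ← mul_assoc,
        ← C_mul]

theorem crossCount_add_sdiff {S Y : Finset ι} (hY : Y ⊆ S) (η : Fin n → ℝ) :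
    crossCount X (S \ Y) η + crossCount X Y η = crossCount X S η := by
  unfold crossCount
  rw [← Finset.card_union_of_disjoint, ← Finset.filter_union, Finset.sdiff_union_of_subset hY]
  exact Finset.disjoint_filter_filter Finset.sdiff_disjoint

/-- The degree of `p_Y` along `η` is at most the number of columns of `Y` crossing `η^⊥`; as `S \ Y`
spans, at least one crossing column of `S` is missing from `Y`. -/
theorem centralSpace_le_facetKernel (S : Finset ι) :
    centralSpace X S ≤ facetKernel X ∅ ⊥ S := by
  rw [centralSpace, Submodule.span_le]
  rintro _ ⟨Y, hYS, hrk, rfl⟩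
  rw [SetLike.mem_coe, mem_facetKernel_bot]
  intro η hη
  rw [facetExp_empty]
  apply dirEnd_pow_prodForm_eq_zero
  obtain ⟨i, hi, hiη⟩ := exists_dotProduct_ne_zero (colSpan_eq_top_of_rk hrk) hη.1
  have := crossCount_pos hi hiη
  have := crossCount_add_sdiff (X := X) hYS η
  omega

/-- When `S` spans, the sum contains `1` and is closed under multiplication by linear forms. Given
`p_Y`, write the form in the columns `i` of `S \ Y`: either `S` without `Y ∪ {i}` still spans, or `Y
∪ {i}` meets every basis in `S`. -/
theorem centralSpace_sup_minorIdeal (S : Finset ι) :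
    centralSpace X S ⊔ (minorIdeal X ∅ ⊥ S).restrictScalars ℂ = ⊤ := by
  classical
  by_cases hS : colSpan X S = ⊤
  swap
  · rw [minorIdeal_eq_top]
    · simp
    · intro B hB
      apply hS
      rw [eq_top_iff, ← hB.sup_eq, bot_sup_eq]
      exact colSpan_mono X hB.subset
  set M := centralSpace X S ⊔ (minorIdeal X ∅ ⊥ S).restrictScalars ℂ with hM
  have hmul : ∀ v : Fin n → ℝ, ∀ p ∈ M, linForm v * p ∈ M := by
    intro v
    suffices h : M ≤ M.comap (LinearMap.mulLeft ℂ (linForm v)) from fun p hp => h hp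
    refine sup_le ?_ fun p hp => Submodule.mem_sup_right (Ideal.mul_mem_left _ _ hp)
    rw [centralSpace, Submodule.span_le]
    rintro _ ⟨Y, hYS, hrk, rfl⟩
    change linForm v * prodForm X Y ∈ M
    have hv : v ∈ colSpan X (S \ Y) := colSpan_eq_top_of_rk hrk ▸ Submodule.mem_top
    induction hv using Submodule.span_induction with
    | mem w hw =>
      obtain ⟨i, hi, rfl⟩ := hw
      have hi' := Finset.mem_sdiff.1 hi
      rw [← prodForm_insert hi'.2]
      by_cases hrk' : colSpan X (S \ insert i Y) = ⊤
      · exact Submodule.mem_sup_left (Submodule.subset_span ⟨insert i Y,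
          Finset.insert_subset hi'.1 hYS, rk_eq_of_colSpan_eq_top hrk', rfl⟩)
      · refine Submodule.mem_sup_right (prodForm_mem_minorIdeal fun B hB => ?_)
        by_contra hne
        rw [Finset.not_nonempty_iff_eq_empty, ← Finset.disjoint_iff_inter_eq_empty] at hne
        apply hrk'
        rw [eq_top_iff, ← hB.sup_eq, bot_sup_eq]
        exact colSpan_mono X (Finset.subset_sdiff.2 ⟨hB.subset, hne.symm⟩)
    | zero =>
      have : linForm (0 : Fin n → ℝ) = 0 := (linFormHom n).map_zero
      rw [this, zero_mul]
      exact zero_mem _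
    | add x y _ _ hx hy =>
      rw [linForm_add, add_mul]
      exact add_mem hx hy
    | smul c x _ hx =>
      rw [linForm_smul, smul_mul_assoc]
      exact M.smul_mem _ hx
  have hone : (1 : Poly n) ∈ M := Submodule.mem_sup_left (Submodule.subset_span
    ⟨∅, Finset.empty_subset S, by rw [Finset.sdiff_empty, rk_eq_of_colSpan_eq_top hS],
      by simp [prodForm]⟩)
  rw [eq_top_iff]
  intro p _
  induction p using MvPolynomial.induction_on with
  | C a =>
    rw [← mul_one (C a), ← smul_eq_C_mul]
    exact M.smul_mem _ hone
  | add p q hp hq => exact add_mem (hp trivial) (hq trivial)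
  | mul_X p i ih =>
    rw [mul_comm, ← linForm_single]
    exact hmul _ _ (ih trivial)

variable {lam : ι → ℝ}

theorem finrank_quotientSpace_minorIdeal_bot {I : Finset ι} (hsimple : IsSimple X lam)
    (S : Finset ι) : Module.finrank ℂ (QuotientSpace (minorIdeal X I ⊥ S)) =
      (minorBases X I ⊥ S).card := by
  have := finrank_quotientSpace_minorIdeal (I := I) hsimple card_empty_eq_finrank S
  rwa [colSpan_empty] at this

variable [Fintype ι]

theorem eq_zero_of_mem_facetKernel_of_mem_minorIdeal {I : Finset ι}
    (hspan : colSpan X Finset.univ = ⊤) (hsimple : IsSimple X lam) {S : Finset ι} {p : Poly n}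
    (hp : p ∈ facetKernel X I ⊥ S) (hp' : p ∈ minorIdeal X I ⊥ S) : p = 0 := by
  apply eq_zero_of_mem_vanishing_bot
  have := mem_vanishing_of_mem_facetKernel (I := I) hspan hsimple S ∅ card_empty_eq_finrank p
  rw [colSpan_empty] at this
  exact this hp' hp

/-- The central space lies in the facet kernel and complements the ideal, while the facet kernel
meets the ideal in `0`. -/
theorem centralSpace_eq_facetKernel (hspan : colSpan X Finset.univ = ⊤)
    (hsimple : IsSimple X lam) (S : Finset ι) : centralSpace X S = facetKernel X ∅ ⊥ S := by
  refine le_antisymm (centralSpace_le_facetKernel S) fun p hp => ?_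
  have hp' : p ∈ centralSpace X S ⊔ (minorIdeal X ∅ ⊥ S).restrictScalars ℂ :=
    centralSpace_sup_minorIdeal (X := X) S ▸ Submodule.mem_top
  obtain ⟨c, hc, j, hj, rfl⟩ := Submodule.mem_sup.1 hp'
  have hjK : j ∈ facetKernel X ∅ ⊥ S :=
    ((facetKernel X ∅ ⊥ S).add_mem_iff_right (centralSpace_le_facetKernel S hc)).1 hp
  rw [eq_zero_of_mem_facetKernel_of_mem_minorIdeal hspan hsimple hjK hj, add_zero]
  exact hc

/-- Deleting `b` lowers the exponent by one exactly at the normals that `b` crosses. Intersecting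
over `b ∈ I` lowers it once, however many elements of `I` cross. -/
theorem semiInternalSpace_eq_facetKernel (hspan : colSpan X Finset.univ = ⊤)
    (hsimple : IsSimple X lam) (I : Finset ι) :
    semiInternalSpace X I = facetKernel X I ⊥ Finset.univ := by
  ext p
  simp only [semiInternalSpace, Submodule.mem_inf, Submodule.mem_iInf,
    centralSpace_eq_facetKernel hspan hsimple, mem_facetKernel_bot, facetExp_empty]
  constructor
  · rintro ⟨h1, h2⟩ η hη
    rw [facetExp]
    split_ifs with hb
    · obtain ⟨b, -, hbI, hbη⟩ := hb
      rw [← crossCount_erase_of_ne_zero (Finset.mem_univ b) hbη]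
      exact h2 b hbI η hη
    · exact h1 η hη
  · intro h
    refine ⟨fun η hη => dirEnd_pow_eq_zero_of_le (Nat.sub_le _ _) (h η hη), fun b hbI η hη => ?_⟩
    by_cases hbη : X b ⬝ᵥ η = 0
    · rw [crossCount_erase_of_eq_zero (Finset.mem_univ b) hbη]
      exact dirEnd_pow_eq_zero_of_le (Nat.sub_le _ _) (h η hη)
    · have := h η hη
      rwa [facetExp, if_pos ⟨b, Finset.mem_univ b, hbI, hbη⟩,
        ← crossCount_erase_of_ne_zero (Finset.mem_univ b) hbη] at this

theorem facetKernel_mkQ_injective {I : Finset ι} (hspan : colSpan X Finset.univ = ⊤)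
    (hsimple : IsSimple X lam) (S : Finset ι) :
    Function.Injective ((((minorIdeal X I ⊥ S).restrictScalars ℂ).mkQ).domRestrict
      (facetKernel X I ⊥ S)) := by
  rw [← LinearMap.ker_eq_bot, LinearMap.ker_eq_bot']
  rintro ⟨p, hp⟩ h0
  apply Subtype.ext
  refine eq_zero_of_mem_facetKernel_of_mem_minorIdeal hspan hsimple hp ?_
  simpa using h0

theorem finite_facetKernel {I : Finset ι} (hspan : colSpan X Finset.univ = ⊤)
    (hsimple : IsSimple X lam) (S : Finset ι) : Module.Finite ℂ (facetKernel X I ⊥ S) := by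
  have := (finrank_quotientSpace_minorIdeal_le (X := X) (I := I) S ⊥).1
  exact Module.Finite.of_injective _ (facetKernel_mkQ_injective hspan hsimple S)

theorem card_minorBases_empty_le (hspan : colSpan X Finset.univ = ⊤)
    (hsimple : IsSimple X lam) (S : Finset ι) :
    (minorBases X ∅ ⊥ S).card ≤ Module.finrank ℂ (facetKernel X ∅ ⊥ S) := by
  have := finite_facetKernel (I := ∅) hspan hsimple S
  rw [← finrank_quotientSpace_minorIdeal_bot hsimple S]
  refine LinearMap.finrank_le_finrank_of_surjective
    (f := (((minorIdeal X ∅ ⊥ S).restrictScalars ℂ).mkQ).domRestrict (facetKernel X ∅ ⊥ S)) ?_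
  intro y
  obtain ⟨p, rfl⟩ := Submodule.mkQ_surjective _ y
  have hp' : p ∈ centralSpace X S ⊔ (minorIdeal X ∅ ⊥ S).restrictScalars ℂ :=
    centralSpace_sup_minorIdeal (X := X) S ▸ Submodule.mem_top
  obtain ⟨c, hc, j, hj, rfl⟩ := Submodule.mem_sup.1 hp'
  have hj0 : ((minorIdeal X ∅ ⊥ S).restrictScalars ℂ).mkQ j = 0 :=
    (Submodule.Quotient.mk_eq_zero _).2 hj
  refine ⟨⟨c, centralSpace_le_facetKernel S hc⟩, ?_⟩
  rw [map_add, hj0, add_zero]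
  rfl

end CentralSpaces

/-! ### Top derivatives along a facet normal. -/

section FacetRestriction

variable {n : ℕ} {ι : Type*} {X : ι → Fin n → ℝ} [LinearOrder ι]

/-- The top derivative along `η` maps `𝒫(T)` to the central space of the columns in `T ∩ η^⊥`. -/
theorem dirEnd_pow_dirEnd_pow_centralSpace {T : Finset ι} {c η ξ : Fin n → ℝ}
    (hcη : c ⬝ᵥ η ≠ 0) (hcξ : c ⬝ᵥ ξ = 0) (hξ : ξ ≠ 0) {p : Poly n} (hp : p ∈ centralSpace X T) :
    (dirEnd ξ ^ crossCount X (T.filter fun i => X i ⬝ᵥ η = 0) ξ)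
      ((dirEnd η ^ (crossCount X T η - 1)) p) = 0 := by
  have hη : η ≠ 0 := by
    rintro rfl
    simp at hcη
  induction hp using Submodule.span_induction with
  | zero => simp
  | add x y _ _ hx hy => rw [map_add, map_add, hx, hy, add_zero]
  | smul a x _ hx => rw [map_smul, map_smul, hx, smul_zero]
  | mem q hq =>
    obtain ⟨Y, hYT, hrk, rfl⟩ := hq
    have htop := colSpan_eq_top_of_rk hrk
    obtain ⟨z, hz, hzη⟩ := exists_dotProduct_ne_zero htop hη
    have hpos := crossCount_pos hz hzη
    have hadd := crossCount_add_sdiff (X := X) hYT η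
    -- With more than one crossing column outside `Y`, the degree of `p_Y` along `η` is too small
    -- for the derivative to survive.
    by_cases h2 : crossCount X (T \ Y) η = 1
    swap
    · rw [dirEnd_pow_prodForm_eq_zero η Y _ (by omega), map_zero]
    obtain ⟨a, ha⟩ := exists_dirEnd_pow_prodForm (X := X) η Y
    rw [show crossCount X T η - 1 = crossCount X Y η by omega, ha, ← smul_eq_C_mul, map_smul,
      dirEnd_pow_prodForm_eq_zero, smul_zero]
    have hsub : (Y.filter fun i => X i ⬝ᵥ η = 0) ⊆ T.filter fun i => X i ⬝ᵥ η = 0 :=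
      Finset.filter_subset_filter _ hYT
    have hadd' := crossCount_add_sdiff (X := X) hsub ξ
    suffices h : ∃ i ∈ T \ Y, X i ⬝ᵥ η = 0 ∧ X i ⬝ᵥ ξ ≠ 0 by
      obtain ⟨i, hi, hiη, hiξ⟩ := h
      rw [Finset.mem_sdiff] at hi
      have := crossCount_pos (X := X) (S := (T.filter fun i => X i ⬝ᵥ η = 0) \
        Y.filter fun i => X i ⬝ᵥ η = 0) (i := i) (by simp [hi, hiη]) hiξ
      omega
    by_contra! hall
    obtain ⟨z', hz'⟩ := Finset.card_eq_one.1 h2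
    have huniq : ∀ i ∈ T \ Y, X i ⬝ᵥ η ≠ 0 → i = z := by
      have hmem : ∀ i ∈ T \ Y, X i ⬝ᵥ η ≠ 0 → i = z' := fun i hi hiη =>
        Finset.mem_singleton.1 (hz' ▸ Finset.mem_filter.2 ⟨hi, hiη⟩)
      intro i hi hiη
      rw [hmem i hi hiη, hmem z hz hzη]
    -- This vector is orthogonal to all of the spanning set `T \ Y`: to `z` by the choice of scalar,
    -- to the rest because they are orthogonal to both `η` and `ξ`. So `ξ` is parallel to `η`,
    -- against `c · ξ = 0 ≠ c · η`.
    have hζ : ξ - ((X z ⬝ᵥ ξ) / (X z ⬝ᵥ η)) • η = 0 := by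
      by_contra hne
      obtain ⟨i, hi, hi0⟩ := exists_dotProduct_ne_zero htop hne
      rw [dotProduct_sub, dotProduct_smul, smul_eq_mul] at hi0
      by_cases hiη : X i ⬝ᵥ η = 0
      · rw [hiη, hall i hi hiη, mul_zero, sub_zero] at hi0
        exact hi0 rfl
      · rw [huniq i hi hiη, div_mul_cancel₀ _ hzη, sub_self] at hi0
        exact hi0 rfl
    rw [sub_eq_zero] at hζ
    rw [hζ, dotProduct_smul, smul_eq_mul, mul_eq_zero, or_iff_left hcη] at hcξ
    rw [hcξ, zero_smul] at hζ
    exact hξ hζ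

variable [Fintype ι] {lam : ι → ℝ}

/-- For each `b ∈ I` use `p ∈ 𝒫(X \ b)`. As `b` lies in the facet, deleting it keeps the order of
the derivative along `η` and lowers by one the count of facet columns crossing `ξ^⊥`. -/
theorem dirEnd_pow_mem_facetKernel (hspan : colSpan X Finset.univ = ⊤)
    (hsimple : IsSimple X lam) {I : Finset ι} {c : ι} {η : Fin n → ℝ} (hcη : X c ⬝ᵥ η ≠ 0)
    (hI : ∀ i ∈ I, X i ⬝ᵥ η = 0) {p : Poly n} (hp : p ∈ facetKernel X I ⊥ Finset.univ) :
    (dirEnd η ^ (crossCount X Finset.univ η - 1)) p ∈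
      facetKernel X I (colSpan X {c}) (Finset.univ.filter fun i => X i ⬝ᵥ η = 0) := by
  rw [← semiInternalSpace_eq_facetKernel hspan hsimple, semiInternalSpace, Submodule.mem_inf] at hp
  simp only [Submodule.mem_iInf] at hp
  intro ξ hξ hξc
  have hcξ : X c ⬝ᵥ ξ = 0 := hξc _ (mem_colSpan X (Finset.mem_singleton_self c))
  suffices h : (dirEnd ξ ^ facetExp X I (Finset.univ.filter fun i => X i ⬝ᵥ η = 0) ξ)
      ((dirEnd η ^ (crossCount X Finset.univ η - 1)) p) = 0 by
    rw [h]
    exact zero_mem _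
  rw [facetExp]
  split_ifs with hb
  · obtain ⟨b, hbA, hbI, hbξ⟩ := hb
    have := dirEnd_pow_dirEnd_pow_centralSpace hcη hcξ hξ.1 (hp.2 b hbI)
    rwa [Finset.filter_erase, crossCount_erase_of_ne_zero hbA hbξ,
      crossCount_erase_of_eq_zero (Finset.mem_univ b) (hI b hbI)] at this
  · exact dirEnd_pow_dirEnd_pow_centralSpace hcη hcξ hξ.1 hp.1

end FacetRestriction

/-! ### The lower bound for the dimension, by enlarging `I`. -/

section LowerBound

variable {n : ℕ} {ι : Type*} {X : ι → Fin n → ℝ} [Fintype ι] {lam : ι → ℝ}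

/-- The columns in a hyperplane with normal `η`. -/
def facetColumns (X : ι → Fin n → ℝ) (η : Fin n → ℝ) : Finset ι :=
  Finset.univ.filter fun i => X i ⬝ᵥ η = 0

theorem mem_facetColumns {η : Fin n → ℝ} {i : ι} : i ∈ facetColumns X η ↔ X i ⬝ᵥ η = 0 := by
  simp [facetColumns]

theorem IsFacetNormal.mem_iff {η : Fin n → ℝ} (h : IsFacetNormal X η) {v : Fin n → ℝ} :
    v ⬝ᵥ η = 0 ↔ v ∈ colSpan X (facetColumns X η) := by
  have hcoe : ((facetColumns X η : Finset ι) : Set ι) = {i | X i ⬝ᵥ η = 0} := by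
    ext i
    simp [mem_facetColumns]
  rw [colSpan, hcoe]
  refine ⟨h.2 v, fun hv => ?_⟩
  have : η ∈ perp (Submodule.span ℝ (X '' {i | X i ⬝ᵥ η = 0})) := by
    rw [mem_perp_span]
    rintro _ ⟨i, hi, rfl⟩
    exact hi
  exact this v hv

theorem IsFacetNormal.exists_smul_eq {η η' : Fin n → ℝ} (h : IsFacetNormal X η)
    (h' : IsFacetNormal X η') (heq : facetColumns X η = facetColumns X η') {c : Fin n → ℝ}
    (hc : c ⬝ᵥ η ≠ 0) : ∃ s : ℝ, η = s • η' := by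
  have hiff : ∀ v : Fin n → ℝ, v ⬝ᵥ η = 0 ↔ v ⬝ᵥ η' = 0 := fun v => by
    rw [h.mem_iff, h'.mem_iff, heq]
  have hc' : c ⬝ᵥ η' ≠ 0 := fun h0 => hc ((hiff c).2 h0)
  have hw : ∀ w : Fin n → ℝ, w ⬝ᵥ (η - ((c ⬝ᵥ η) / (c ⬝ᵥ η')) • η') = 0 := by
    intro w
    have h0 : (w - ((w ⬝ᵥ η) / (c ⬝ᵥ η)) • c) ⬝ᵥ η = 0 := by
      rw [sub_dotProduct, smul_dotProduct, smul_eq_mul, div_mul_cancel₀ _ hc, sub_self]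
    have h1 := (hiff _).1 h0
    rw [sub_dotProduct, smul_dotProduct, smul_eq_mul, sub_eq_zero] at h1
    rw [dotProduct_sub, dotProduct_smul, smul_eq_mul, h1]
    field_simp
    ring
  exact ⟨(c ⬝ᵥ η) / (c ⬝ᵥ η'), sub_eq_zero.1 (dotProduct_self_eq_zero.1 (hw _))⟩

theorem crossCount_univ_eq_of_facetColumns_eq {η η' : Fin n → ℝ}
    (heq : facetColumns X η = facetColumns X η') :
    crossCount X Finset.univ η = crossCount X Finset.univ η' := by
  unfold crossCount
  congr 1
  ext i
  have : i ∈ facetColumns X η ↔ i ∈ facetColumns X η' := by rw [heq]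
  rw [mem_facetColumns, mem_facetColumns] at this
  simp [this]

/-- The facets that contain `I` and do not contain the column `c`. -/
def avoidingFacets (X : ι → Fin n → ℝ) (I : Finset ι) (c : ι) : Finset (Finset ι) :=
  haveI := Classical.decPred fun A : Finset ι =>
    ∃ η, IsFacetNormal X η ∧ A = facetColumns X η ∧ I ⊆ A ∧ X c ⬝ᵥ η ≠ 0
  Finset.univ.filter fun A =>
    ∃ η, IsFacetNormal X η ∧ A = facetColumns X η ∧ I ⊆ A ∧ X c ⬝ᵥ η ≠ 0

theorem mem_avoidingFacets {I : Finset ι} {c : ι} {A : Finset ι} : A ∈ avoidingFacets X I c ↔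
    ∃ η, IsFacetNormal X η ∧ A = facetColumns X η ∧ I ⊆ A ∧ X c ⬝ᵥ η ≠ 0 := by
  classical
  rw [avoidingFacets, Finset.mem_filter, and_iff_right (Finset.mem_univ A)]

variable [LinearOrder ι]

theorem mem_colSpan_of_isMinorBasis {I B : Finset ι} {c : ι} {η : Fin n → ℝ}
    (hcη : X c ⬝ᵥ η ≠ 0) (hB : IsMinorBasis X I (colSpan X {c}) (facetColumns X η) B)
    {v : Fin n → ℝ} : v ∈ colSpan X B ↔ v ⬝ᵥ η = 0 := by
  have hperp : η ∈ perp (colSpan X B) := by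
    rw [colSpan, mem_perp_span]
    rintro _ ⟨i, hi, rfl⟩
    exact mem_facetColumns.1 (hB.subset hi)
  refine ⟨fun hv => hperp v hv, fun hv => ?_⟩
  obtain ⟨y, hy, w, hw, rfl⟩ := Submodule.mem_sup.1 (hB.sup_eq ▸ Submodule.mem_top : v ∈ _)
  rw [colSpan, Finset.coe_singleton, Set.image_singleton] at hy
  obtain ⟨s, rfl⟩ := Submodule.mem_span_singleton.1 hy
  rw [add_dotProduct, hperp w hw, add_zero, smul_dotProduct, smul_eq_mul, mul_eq_zero,
    or_iff_left hcη] at hv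
  rwa [hv, zero_smul, zero_add]

/-- A basis `B` of a facet that contains `I` and avoids `c` yields the `I`-internal basis `B ∪ {c}`.
There `c` is active once it joins `I`, because all columns after `c` belong to `I`, hence to the
facet. -/
theorem sum_card_minorBases_add_le {I : Finset ι} {c : ι} (hmin : ∀ i ∈ I, c < i)
    (hup : ∀ i, c < i → i ∈ I) :
    ∑ A ∈ avoidingFacets X I c, (minorBases X I (colSpan X {c}) A).card +
      (minorBases X (insert c I) ⊥ Finset.univ).card ≤ (minorBases X I ⊥ Finset.univ).card := by
  classical
  have hcI : c ∉ I := fun h => lt_irrefl _ (hmin c h)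
  have hcB : ∀ {A B}, A ∈ avoidingFacets X I c → B ∈ minorBases X I (colSpan X {c}) A →
      c ∉ B := by
    intro A B hA hB hc
    obtain ⟨η, -, rfl, -, hcη⟩ := mem_avoidingFacets.1 hA
    exact hcη (mem_facetColumns.1 ((mem_minorBases.1 hB).subset hc))
  let P := (avoidingFacets X I c).sigma fun A => minorBases X I (colSpan X {c}) A
  let f : (Σ _ : Finset ι, Finset ι) → Finset ι := fun s => insert c s.2
  have hinj : Set.InjOn f (P : Set (Σ _ : Finset ι, Finset ι)) := by
    rintro ⟨A, B⟩ h ⟨A', B'⟩ h' heq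
    obtain ⟨hA, hB⟩ := Finset.mem_sigma.1 h
    obtain ⟨hA', hB'⟩ := Finset.mem_sigma.1 h'
    have hBB : B = B' := by
      have heq' : insert c B = insert c B' := heq
      have h1 : c ∉ B := hcB hA hB
      have h2 : c ∉ B' := hcB hA' hB'
      rw [← Finset.erase_insert h1, heq', Finset.erase_insert h2]
    subst hBB
    obtain ⟨η, -, rfl, -, hcη⟩ := mem_avoidingFacets.1 hA
    obtain ⟨η', -, rfl, -, hcη'⟩ := mem_avoidingFacets.1 hA'
    -- The facet is recovered from `B`, which spans `η^⊥`.
    have : facetColumns X η = facetColumns X η' := by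
      ext i
      rw [mem_facetColumns, mem_facetColumns,
        ← mem_colSpan_of_isMinorBasis hcη (mem_minorBases.1 hB),
        ← mem_colSpan_of_isMinorBasis hcη' (mem_minorBases.1 hB')]
    rw [this]
  rw [← Finset.card_sigma, ← Finset.card_image_of_injOn hinj, ← Finset.card_union_of_disjoint]
  · refine Finset.card_le_card (Finset.union_subset ?_ ?_)
    · intro B hB
      obtain ⟨⟨A, B⟩, hs, rfl⟩ := Finset.mem_image.1 hB
      obtain ⟨hA, hB⟩ := Finset.mem_sigma.1 hs
      have hc := hcB hA hB
      replace hB := mem_minorBases.1 hB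
      obtain ⟨η, -, rfl, -, hcη⟩ := mem_avoidingFacets.1 hA
      have hc0 : X c ≠ 0 := by
        intro h0
        rw [h0, zero_dotProduct] at hcη
        exact hcη rfl
      have hsing : ∀ T : Finset ι, (⊥ : Submodule ℝ (Fin n → ℝ)) ⊔ colSpan X (insert c T) =
          colSpan X {c} ⊔ colSpan X T := by
        intro T
        rw [bot_sup_eq, Finset.insert_eq, colSpan_union]
      refine mem_minorBases.2 ⟨Finset.subset_univ _, ?_, ?_, ?_⟩
      · have := hB.card_add
        rw [← card_singleton_eq_finrank hc0, Finset.card_singleton] at this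
        rw [Finset.card_insert_of_notMem hc]
        simpa using this
      · rw [hsing, hB.sup_eq]
      · intro b hb hbI
        have hbc : b ≠ c := by
          rintro rfl
          exact hcI hbI
        have hbB := (Finset.mem_insert.1 hb).resolve_left hbc
        obtain ⟨i, -, hlt, hni⟩ := hB.inactive b hbB hbI
        refine ⟨i, Finset.mem_univ i, hlt, ?_⟩
        rwa [Finset.erase_insert_of_ne hbc.symm, hsing]
    · intro B hB
      replace hB := mem_minorBases.1 hB
      exact mem_minorBases.2 ⟨hB.subset, hB.card_add, hB.sup_eq, fun b hb hbI =>
        hB.inactive b hb (Finset.mem_insert_of_mem hbI)⟩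
  · rw [Finset.disjoint_left]
    intro B hB hB'
    obtain ⟨⟨A, B⟩, hs, rfl⟩ := Finset.mem_image.1 hB
    obtain ⟨hA, hB⟩ := Finset.mem_sigma.1 hs
    have hc := hcB hA hB
    replace hB := mem_minorBases.1 hB
    obtain ⟨η, -, rfl, hIA, hcη⟩ := mem_avoidingFacets.1 hA
    obtain ⟨i, -, hlt, hni⟩ := (mem_minorBases.1 hB').inactive c (Finset.mem_insert_self c B)
      (Finset.mem_insert_self c I)
    rw [Finset.erase_insert hc, bot_sup_eq, mem_colSpan_of_isMinorBasis hcη hB] at hni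
    exact hni (mem_facetColumns.1 (hIA (hup i hlt)))

/-- The exponent drops only at normals crossed by `c` and by no element of `I`. There the derivative
of order `m - 1` is constant along `η`, so its vanishing on `c^⊥` makes it zero. One normal per
facet suffices, since normals agree up to scaling. -/
theorem mem_facetKernel_insert {I : Finset ι} {c : ι} {p : Poly n}
    (hp : p ∈ facetKernel X I ⊥ Finset.univ)
    (h : ∀ A ∈ avoidingFacets X I c, ∃ η, IsFacetNormal X η ∧ A = facetColumns X η ∧
      X c ⬝ᵥ η ≠ 0 ∧ (dirEnd η ^ (crossCount X Finset.univ η - 1)) p ∈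
        vanishing (Submodule.span ℝ {X c})) :
    p ∈ facetKernel X (insert c I) ⊥ Finset.univ := by
  rw [mem_facetKernel_bot] at hp ⊢
  intro ξ hξ
  have hpξ := hp ξ hξ
  rw [facetExp] at hpξ ⊢
  by_cases hb : ∃ b ∈ Finset.univ, b ∈ I ∧ X b ⬝ᵥ ξ ≠ 0
  · rw [if_pos hb] at hpξ
    obtain ⟨b, hb, hbI, hbξ⟩ := hb
    rwa [if_pos ⟨b, hb, Finset.mem_insert_of_mem hbI, hbξ⟩]
  rw [if_neg hb, Nat.sub_zero] at hpξ
  by_cases hcξ : X c ⬝ᵥ ξ = 0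
  · exact dirEnd_pow_eq_zero_of_le (Nat.le_sub_of_add_le (by
      rw [if_neg, add_zero]
      rintro ⟨b, hb', hbI, hbξ⟩
      rcases Finset.mem_insert.1 hbI with rfl | hbI
      · exact hbξ hcξ
      · exact hb ⟨b, hb', hbI, hbξ⟩)) hpξ
  rw [if_pos ⟨c, Finset.mem_univ c, Finset.mem_insert_self c I, hcξ⟩]
  have hIξ : I ⊆ facetColumns X ξ := fun i hi => by
    rw [mem_facetColumns]
    by_contra hne
    exact hb ⟨i, Finset.mem_univ i, hi, hne⟩
  obtain ⟨η, hη, heq, hcη, hmem⟩ := h _ (mem_avoidingFacets.2 ⟨ξ, hξ, rfl, hIξ, hcξ⟩)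
  have hcount := crossCount_univ_eq_of_facetColumns_eq heq
  obtain ⟨s, hs⟩ := hη.exists_smul_eq hξ heq.symm hcη
  obtain ⟨s', hs'⟩ := hξ.exists_smul_eq hη heq hcξ
  have hpos := crossCount_pos (Finset.mem_univ c) hcη
  have hD : dirEnd η ((dirEnd η ^ (crossCount X Finset.univ η - 1)) p) = 0 := by
    rw [← Module.End.mul_apply, ← pow_succ', Nat.sub_add_cancel hpos, ← hcount]
    conv_lhs => rw [hs, dirEnd_smul, smul_pow, LinearMap.smul_apply]
    rw [hpξ, smul_zero]
  have h0 := eq_zero_of_dirEnd_eq_zero hcη hD hmem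
  rw [hcount]
  conv_lhs => rw [hs', dirEnd_smul, smul_pow, LinearMap.smul_apply]
  rw [h0, smul_zero]

/-- Adding the column `c` before `I`, the top derivatives along the avoiding facets, restricted to
`c^⊥`, have joint kernel inside the new space. The dimension lost is bounded by the internal bases
of the facet minors, and the number of internal bases drops by at least as much. -/
theorem card_minorBases_le_finrank_facetKernel (hspan : colSpan X Finset.univ = ⊤)
    (hsimple : IsSimple X lam) (I : Finset ι) :
    (∀ i ∈ I, ∀ j, i < j → j ∈ I) →
      (minorBases X I ⊥ Finset.univ).card ≤
        Module.finrank ℂ (facetKernel X I ⊥ Finset.univ) := by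
  classical
  refine Finset.induction_on_min I (fun _ => card_minorBases_empty_le hspan hsimple _) ?_
  intro c I hmin ih hup
  have hcup : ∀ i, c < i → i ∈ I := fun i hi =>
    (Finset.mem_insert.1 (hup c (Finset.mem_insert_self c I) i hi)).resolve_left hi.ne'
  have hle := ih fun i hi j hij => hcup j ((hmin i hi).trans hij)
  have hcount := sum_card_minorBases_add_le (X := X) hmin hcup
  have hfin := finite_facetKernel (I := I) hspan hsimple Finset.univ
  have hfin' := finite_facetKernel (I := insert c I) hspan hsimple Finset.univ
  choose η hη using fun A : avoidingFacets X I c => mem_avoidingFacets.1 A.2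
  let Q := (vanishing (colSpan X {c})).restrictScalars ℂ
  let N : avoidingFacets X I c → Submodule ℂ (Poly n ⧸ Q) := fun A =>
    (facetKernel X I (colSpan X {c}) A).map Q.mkQ
  have hN : ∀ A, Module.Finite ℂ (N A) ∧
      Module.finrank ℂ (N A) ≤ (minorBases X I (colSpan X {c}) A).card := by
    intro A
    refine finrank_map_facetKernel_le hspan hsimple A (card_singleton_eq_finrank ?_)
    intro h0
    have := (hη A).2.2.2
    rw [h0, zero_dotProduct] at this
    exact this rfl
  have hNfin : ∀ A, Module.Finite ℂ (N A) := fun A => (hN A).1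
  have hmain := finrank_le_sum_finrank_add (K := ℂ) (M := facetKernel X I ⊥ Finset.univ)
    (M' := facetKernel X (insert c I) ⊥ Finset.univ) N
    (fun A => Q.mkQ ∘ₗ (dirEnd (η A) ^ (crossCount X Finset.univ (η A) - 1)))
    (fun A p hp => by
      refine ⟨_, ?_, rfl⟩
      have := dirEnd_pow_mem_facetKernel hspan hsimple (hη A).2.2.2
        (fun i hi => mem_facetColumns.1 ((hη A).2.1 ▸ (hη A).2.2.1 hi)) hp
      rw [(hη A).2.1]
      exact this)
    (fun p hp h => mem_facetKernel_insert hp fun A hA => by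
      refine ⟨η ⟨A, hA⟩, (hη ⟨A, hA⟩).1, (hη ⟨A, hA⟩).2.1, (hη ⟨A, hA⟩).2.2.2, ?_⟩
      have h0 := (Submodule.Quotient.mk_eq_zero Q).1 (h ⟨A, hA⟩)
      rw [Submodule.restrictScalars_mem, colSpan, Finset.coe_singleton, Set.image_singleton] at h0
      exact h0)
  have hsum : ∑ A, Module.finrank ℂ (N A) ≤
      ∑ A ∈ avoidingFacets X I c, (minorBases X I (colSpan X {c}) A).card := by
    rw [← Finset.sum_coe_sort (avoidingFacets X I c)
      fun A => (minorBases X I (colSpan X {c}) A).card]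
    exact Finset.sum_le_sum fun A _ => (hN A).2
  omega

end LowerBound

/-! ### Internal bases and the long ideal as the case of the trivial minor. -/

section Translation

variable {n : ℕ} {ι : Type*} {X : ι → Fin n → ℝ}

theorem isBasis_iff {B : Finset ι} : IsBasis X B ↔ B.card = n ∧ colSpan X B = ⊤ := by
  have hrange : Set.range (fun i : B => X i) = X '' (B : Set ι) := by
    ext v
    simp
  constructor
  · rintro ⟨h1, h2⟩
    refine ⟨?_, h2⟩
    have h3 := finrank_span_eq_card h1
    rw [hrange, h2, finrank_top, Module.finrank_fin_fun, Fintype.card_coe] at h3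
    exact h3.symm
  · rintro ⟨h1, h2⟩
    refine ⟨linearIndependent_of_top_le_span_of_card_eq_finrank ?_ (by simp [h1]), h2⟩
    rw [hrange]
    exact h2.ge

variable [LinearOrder ι] [Fintype ι] {I : Finset ι}

theorem mem_internalBases_iff {B : Finset ι} :
    B ∈ internalBases X I ↔ IsMinorBasis X I ⊥ Finset.univ B := by
  constructor
  · rintro ⟨hB, hact⟩
    obtain ⟨h1, h2⟩ := isBasis_iff.1 hB
    refine ⟨Finset.subset_univ B, by simpa using h1, by rw [bot_sup_eq, h2], fun b hb hbI => ?_⟩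
    by_contra! hall
    refine hact b hb ⟨hbI, ?_, fun i hi => ?_⟩
    · have := notMem_sup_colSpan_erase (W := ⊥) (by simpa using h1) (by rw [bot_sup_eq, h2]) hb
      rwa [bot_sup_eq] at this
    · by_contra hlt
      rw [not_le] at hlt
      apply hi
      have := hall i (Finset.mem_univ i) hlt
      rwa [bot_sup_eq] at this
  · intro hB
    refine ⟨isBasis_iff.2 ⟨by simpa using hB.card_add, by simpa using hB.sup_eq⟩, ?_⟩
    rintro b hb ⟨hbI, hmax⟩
    obtain ⟨i, -, hlt, hni⟩ := hB.inactive b hb hbI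
    rw [bot_sup_eq] at hni
    exact absurd (hmax.2 hni) (not_le.2 hlt)

theorem internalBases_eq_coe : internalBases X I = (minorBases X I ⊥ Finset.univ : Set _) := by
  ext B
  rw [mem_internalBases_iff, Finset.mem_coe, mem_minorBases]

theorem longIdeal_eq_minorIdeal : longIdeal X I = minorIdeal X I ⊥ Finset.univ := by
  have hlong : ∀ Y, IsLong X I Y ↔ IsMinorLong X I ⊥ Finset.univ Y := fun Y =>
    forall_congr' fun B => by rw [mem_internalBases_iff]
  have hbot : vanishing (⊥ : Submodule ℝ (Fin n → ℝ)) = ⊥ :=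
    eq_bot_iff.2 fun p hp => (Submodule.mem_bot _).2 (eq_zero_of_mem_vanishing_bot hp)
  simp only [longIdeal, minorIdeal, hbot, bot_sup_eq, hlong]

end Translation

/-! ### Recovering an ideal from its kernel. -/

section Duality

variable {n : ℕ}

/-- If the kernel of an ideal of finite codimension has full dimension, then its annihilator is the
ideal. -/
theorem mem_of_pairing_idealKer_eq_zero {J : Ideal (Poly n)} [Module.Finite ℂ (QuotientSpace J)]
    (h : Module.finrank ℂ (idealKer J) = Module.finrank ℂ (QuotientSpace J)) {p : Poly n}
    (hp : ∀ q ∈ idealKer J, pairing n p q = 0) : p ∈ J := by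
  by_contra hpJ
  obtain ⟨hfin, hfr⟩ := finite_dualAnnihilator J
  obtain ⟨hfin', -⟩ := finrank_idealKer_le J
  -- Every functional that kills `J` is thus a pairing with an element of the kernel, including one
  -- that separates `p` from `J`.
  have hsurj : Function.Surjective (kerToAnnihilator J) :=
    (LinearMap.injective_iff_surjective_of_finrank_eq_finrank (h.trans hfr.symm)).1
      (kerToAnnihilator_injective J)
  obtain ⟨φ, hφp, hφ⟩ :=
    Submodule.exists_le_ker_of_notMem (p := J.restrictScalars ℂ) (v := p) hpJ
  obtain ⟨q, hq⟩ := hsurj ⟨φ, (Submodule.mem_dualAnnihilator φ).2 fun w hw => hφ hw⟩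
  apply hφp
  have : φ p = pairing n p q := congrArg (fun f => (f : Module.Dual ℂ (Poly n)) p)
    (congrArg Subtype.val hq).symm
  rw [this, hp q q.2]

end Duality

end Zonotopal

end

/-! ### The theorem, by comparison of dimensions. -/

theorem theorem3p5 {n : ℕ} {ι : Type*} [Fintype ι] [LinearOrder ι]
    (X : ι → Fin n → ℝ) (hX : ∀ i, X i ≠ 0) (hrank : Zonotopal.rk X Finset.univ = n)
    (I : Finset ι) (hI : Zonotopal.IsIndep X I) (hlast : ∀ x ∉ I, ∀ y ∈ I, x < y)
    (lam : ι → ℝ) (hsimple : Zonotopal.IsSimple X lam) :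
    (Zonotopal.dualSpace X I = Zonotopal.leastSpace (Zonotopal.internalVertices X lam I) ∧
      Module.Finite ℂ (Zonotopal.dualSpace X I) ∧
      Module.finrank ℂ (Zonotopal.dualSpace X I) = (Zonotopal.internalBases X I).ncard) ∧
    IsCompl ((Zonotopal.longIdeal X I).restrictScalars ℂ) (Zonotopal.semiInternalSpace X I) ∧
    Function.Bijective ((Zonotopal.pairing n).domRestrict₁₂
      (Zonotopal.semiInternalSpace X I) (Zonotopal.dualSpace X I)) := by
  open Zonotopal in
  have hspan : colSpan X Finset.univ = ⊤ := colSpan_eq_top_of_rk hrank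
  have hup : ∀ i ∈ I, ∀ j, i < j → j ∈ I := fun i hi j hij => by
    by_contra hj
    exact lt_asymm hij (hlast j hj i hi)
  rw [semiInternalSpace_eq_facetKernel hspan hsimple, dualSpace, longIdeal_eq_minorIdeal,
    internalBases_eq_coe, Set.ncard_coe_finset]
  have hcodim := finrank_quotientSpace_minorIdeal_bot (I := I) hsimple Finset.univ
  have hfinQ := (finrank_quotientSpace_minorIdeal_le (X := X) (I := I) Finset.univ ⊥).1
  have hlower := card_minorBases_le_finrank_facetKernel hspan hsimple I hup
  have hinj := facetKernel_mkQ_injective (I := I) hspan hsimple Finset.univ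
  have hfinK := finite_facetKernel (I := I) hspan hsimple Finset.univ
  have hupper := LinearMap.finrank_le_finrank_of_injective hinj
  obtain ⟨hfinD, hD⟩ := finrank_idealKer_le (minorIdeal X I ⊥ Finset.univ)
  obtain ⟨V, hVcard, hV⟩ := exists_vertices (I := I) hsimple card_empty_eq_finrank Finset.univ
  have hVeq : internalVertices X lam I = (V : Set (Fin n → ℝ)) := by
    ext v
    rw [Finset.mem_coe, hV, colSpan_empty]
    simp only [internalVertices, Set.mem_ofPred_eq, mem_internalBases_iff, mem_iInter_hyperplane,
      Finset.union_empty]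
  have hle := leastSpace_le_idealKer_minorIdeal (X := X) (I := I) (lam := lam) (C := ∅)
    (S := Finset.univ) (V := V) fun v hv => (hV v).1 hv
  rw [colSpan_empty] at hle hVcard
  have hfinL : Module.Finite ℂ (leastSpace (V : Set (Fin n → ℝ))) :=
    Module.Finite.of_injective _ (Submodule.inclusion_injective hle)
  have hcardV := card_le_finrank_leastSpace V
  have hmono := Submodule.finrank_mono hle
  have hDeq : Module.finrank ℂ (idealKer (minorIdeal X I ⊥ Finset.univ)) =
      (minorBases X I ⊥ Finset.univ).card := by
    refine le_antisymm (hD.trans hcodim.le) ?_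
    rw [← hVcard]
    exact hcardV.trans hmono
  -- Transversality gives the upper bound, the induction on `I` the lower one; the facet kernel thus
  -- has the dimension of a complement of the ideal.
  have hKeq : Module.finrank ℂ (facetKernel X I ⊥ Finset.univ) =
      (minorBases X I ⊥ Finset.univ).card := le_antisymm (hupper.trans hcodim.le) hlower
  refine ⟨⟨?_, hfinD, hDeq⟩, ⟨?_, ?_⟩, ?_⟩
  · rw [hVeq]
    refine (Submodule.eq_of_le_of_finrank_le hle ?_).symm
    rw [hDeq, ← hVcard]
    exact hcardV
  · rw [Submodule.disjoint_def]
    exact fun p hpJ hpK => eq_zero_of_mem_facetKernel_of_mem_minorIdeal hspan hsimple hpK hpJ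
  · have hsurj := (LinearMap.injective_iff_surjective_of_finrank_eq_finrank
      (hKeq.trans hcodim.symm)).1 hinj
    rw [codisjoint_iff, eq_top_iff]
    intro p _
    obtain ⟨k, hk⟩ := hsurj (Submodule.mkQ _ p)
    have hsub : p - k ∈ (minorIdeal X I ⊥ Finset.univ).restrictScalars ℂ :=
      (Submodule.Quotient.eq _).1 hk.symm
    rw [← sub_add_cancel p k]
    exact Submodule.add_mem_sup hsub k.2
  · have hpinj : Function.Injective ((pairing n).domRestrict₁₂ (facetKernel X I ⊥ Finset.univ)
        (idealKer (minorIdeal X I ⊥ Finset.univ))) := by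
      rw [← LinearMap.ker_eq_bot, LinearMap.ker_eq_bot']
      intro p hp
      apply Subtype.ext
      refine eq_zero_of_mem_facetKernel_of_mem_minorIdeal hspan hsimple p.2 ?_
      exact mem_of_pairing_idealKer_eq_zero (hDeq.trans hcodim.symm)
        fun q hq => congrArg (fun f => f ⟨q, hq⟩) hp
    refine ⟨hpinj, (LinearMap.injective_iff_surjective_of_finrank_eq_finrank ?_).1 hpinj⟩
    exact (hKeq.trans hDeq.symm).trans (Subspace.dual_finrank_eq (K := ℂ)).symm
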